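/- Consider pairs $(\omega,v)$ of discrete measures on $\mathbb{R}$ of the form $\omega=\sum_{i=1}^n\omega_i\delta_{x_i}$, $v=\sum_{i=1}^n v_i\delta_{x_i}$ with $n\ge 0$, $x_1<\dots<x_n$, $\omega_i\in\mathbb{R}$, $v_i\ge 0$ and $|\omega_i|+v_i>0$; neither $n$ nor the points $x_i$ are prescribed. For $z\in\mathbb{C}$, a solution of $$-f''+\tfrac14 f=z\omega f+z^2 v f\quad\text{on }\mathbb{R}$$ is a continuous function $f:\mathbb{R}\to\mathbb{C}$ with $-f''+\frac14 f=0$ on $\mathbb{R}\setminus\{x_1,\dots,x_n\}$ and $f'(x_i-)=f'(x_i+)+z\omega_i f(x_i)+z^2v_i f(x_i)$ for $i=1,\dots,n$. The eigenvalues of $(\omega,v)$ are the numbers $z\in\mathbb{C}$ for which there is a nontrivial bounded solution. It is known that they are real, nonzero and finite in number; write them as $\lambda_1<\dots<\lambda_N$. Let $\phi_+(z,\cdot)$ be the solution with $\phi_+(z,x)=e^{-x/2}$ for all $x$ near $+\infty$, and put $$\gamma_{\lambda_i}^2=\int_{\mathbb{R}}|\phi_+(\lambda_i,x)|^2\,d\omega(x)+2\lambda_i\int_{\mathbb{R}}|\phi_+(\lambda_i,x)|^2\,dv(x),\qquad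 \varphi_i(x)=\frac{\phi_+(\lambda_i,x)}{\sqrt{\lambda_i\gamma_{\lambda_i}^2}},$$ where $\lambda_i\gamma_{\lambda_i}^2>0$. Fix $a\in\mathbb{R}$ and set $$\alpha=1-\sum_{i=1}^N|\varphi_i(a)|^2,\qquad \beta=-\sum_{i=1}^N\lambda_i|\varphi_i(a)|^2 .$$ **Theorem.** Suppose that $\varphi_i(a)\neq0$ for $i=1,\dots,N$. Consider the pairs $(\tilde\omega,\tilde v)$ of the above form that have exactly the eigenvalues $\lambda_1<\dots<\lambda_N$ and whose normalized eigenfunctions $\tilde\varphi_i$ satisfy $|\tilde\varphi_i(a)|=|\varphi_i(a)|$ for $i=1,\dots,N$. The number of these pairs, including $(\omega,v)$ itself, is (i) exactly $2^{N-2}$ if $\alpha=\beta=0$ (in which case $N\ge2$); (ii) exactly $2^{N-1}$ if $\alpha=0$ and $\beta\neq0$ (in which case $N\ge1$); (iii) exactly $2^{N}$ if $\alpha\neq0$. -/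

import Mathlib

open scoped NNReal

namespace PeakonString

/-- A pair of discrete measures `ω = ∑ ωᵢ δ_{xᵢ}` (real weights) and `v = ∑ vᵢ δ_{xᵢ}`
(nonnegative weights) on the real line, each given by its finitely supported weight function
`x ↦ ω({x})`, `x ↦ v({x})`. The points `xᵢ`, at which `|ωᵢ| + vᵢ > 0`, are the points where one of
the two weight functions does not vanish; their number is not prescribed. -/
abbrev MeasurePair : Type := (ℝ →₀ ℝ) × (ℝ →₀ ℝ≥0)

/-- The finite set `{x₁, …, xₙ}` of points that carry mass of `ω` or of `v`. -/
noncomputable def MeasurePair.points (p : MeasurePair) : Finset ℝ :=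
  p.1.support ∪ p.2.support

/-- `f` solves `-f'' + f / 4 = z ω f + z² v f` on the line: `f` is continuous,
`-f'' + f / 4 = 0` away from the points `xᵢ`, and at each `xᵢ` the one-sided limits of `f'`
exist and satisfy `f'(xᵢ-) = f'(xᵢ+) + z ωᵢ f(xᵢ) + z² vᵢ f(xᵢ)`. -/
structure IsSolution (p : MeasurePair) (z : ℂ) (f : ℝ → ℂ) : Prop where
  continuous : Continuous f
  differentiableAt : ∀ x ∉ p.points, DifferentiableAt ℝ f x
  ode : ∀ x ∉ p.points, HasDerivAt (deriv f) (f x / 4) x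
  jump : ∀ x ∈ p.points, ∃ dl dr : ℂ,
    Filter.Tendsto (deriv f) (nhdsWithin x (Set.Iio x)) (nhds dl) ∧
    Filter.Tendsto (deriv f) (nhdsWithin x (Set.Ioi x)) (nhds dr) ∧
    dl = dr + z * ((p.1 x : ℝ) : ℂ) * f x + z ^ 2 * (((p.2 x : ℝ≥0) : ℝ) : ℂ) * f x

/-- The set of eigenvalues: all complex `z` for which there is a nontrivial bounded solution. -/
def eigenvalues (p : MeasurePair) : Set ℂ :=
  {z | ∃ f : ℝ → ℂ, IsSolution p z f ∧ f ≠ 0 ∧ ∃ C : ℝ, ∀ x, ‖f x‖ ≤ C}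

/-- `f` is the solution `φ₊(z, ·)`, which equals `e^{-x/2}` for all `x` near `+∞`. -/
def IsPhiPlus (p : MeasurePair) (z : ℂ) (f : ℝ → ℂ) : Prop :=
  IsSolution p z f ∧ ∀ᶠ x : ℝ in Filter.atTop, f x = ((Real.exp (-x / 2) : ℝ) : ℂ)

/-- `γ² = ∫ |f|² dω + 2 μ ∫ |f|² dv`; used with `μ` an eigenvalue and `f = φ₊(μ, ·)`. -/
noncomputable def gammaSq (p : MeasurePair) (μ : ℝ) (f : ℝ → ℂ) : ℝ :=
  (p.1.sum fun x m => ‖f x‖ ^ 2 * m) + 2 * μ * (p.2.sum fun x m => ‖f x‖ ^ 2 * (m : ℝ))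

/-- `g` is the normalized eigenfunction `φ₊(μ, ·) / √(μ γ²)` of the eigenvalue `μ`. -/
def IsNormalizedEigenfunction (p : MeasurePair) (μ : ℝ) (g : ℝ → ℂ) : Prop :=
  ∃ f : ℝ → ℂ, IsPhiPlus p (μ : ℂ) f ∧
    ∀ x, g x = f x / ((Real.sqrt (μ * gammaSq p μ f) : ℝ) : ℂ)

/-- `{(λᵢ, cᵢ)}` is the interior spectral data at `a`: `λ₁ < ⋯ < λ_N` are all the eigenvalues,
and `cᵢ = φᵢ(a)` for the normalized eigenfunction `φᵢ` of `λᵢ`. -/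
structure IsInteriorSpectralData (p : MeasurePair) (a : ℝ) {N : ℕ}
    (lam : Fin N → ℝ) (c : Fin N → ℂ) : Prop where
  strictMono : StrictMono lam
  eigenvalues_eq : eigenvalues p = Set.range fun i => (lam i : ℂ)
  value : ∀ i, ∃ g : ℝ → ℂ, IsNormalizedEigenfunction p (lam i) g ∧ g a = c i

/-- `α = 1 - ∑ |φᵢ(a)|²`. -/
noncomputable def alpha {N : ℕ} (c : Fin N → ℂ) : ℝ := 1 - ∑ i, ‖c i‖ ^ 2

/-- `β = - ∑ λᵢ |φᵢ(a)|²`. -/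
noncomputable def beta {N : ℕ} (lam : Fin N → ℝ) (c : Fin N → ℂ) : ℝ :=
  -∑ i, lam i * ‖c i‖ ^ 2

/-- All pairs `(ω̃, ṽ)` with `λ̃ᵢ = λᵢ` and `|φ̃ᵢ(a)| = |φᵢ(a)|`, `i = 1, …, N`. -/
def equimodularPairs (a : ℝ) {N : ℕ} (lam : Fin N → ℝ) (c : Fin N → ℂ) : Set MeasurePair :=
  {q | ∃ c' : Fin N → ℂ, IsInteriorSpectralData q a lam c' ∧ ∀ i, ‖c' i‖ = ‖c i‖}

end PeakonString

namespace PeakonString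

open Filter Topology Polynomial

/-! Everything is encoded in two real polynomials in `z`: the Wronskian `W` of the two decaying
solutions and the numerator `B = φ₊(·, a) φ₋(·, a)` of the diagonal Green's function at `a`, both
equal to `1` at `0`. The eigenvalues are the zeros of `W` (`mem_eigenvalues_iff`). Differentiating
the Green equation in `z` gives `W'(λ) c = -γ²`, where `φ₊ = c φ₋` at the eigenvalue `λ`; together
with `φ₊(λ, a)² = c B(λ)` this turns the prescribed moduli into `B(λᵢ) = -λᵢ |φᵢ(a)|² W'(λᵢ)`. Since
`deg B ≤ N`, these values and `B(0) = 1` determine `B`, so the admissible pairs are those with the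
same `W` and `B` as the given one (`mem_equimodularPairs_iff`, `IsGreenData.interpolation_unique`).

Cutting the line at `a` gives `B = g₊ g₋` and `W = B - z (d₊ g₋ + d₋ g₊) - z ρ B`, with `ρ` the
linear polynomial of the mass at `a` (`wronskian_eq`). Each quotient `d± / g±` is a rational
Herglotz function vanishing at infinity, with `g±(0) = 1`. Conversely every such quotient comes from
exactly one configuration on the half-line: it is expanded in a continued fraction whose terms are
the gaps and the masses (`density_eq_of_half_eq`, `IsHerglotzPair.exists_half`).

Fixing `W` and `B` fixes `ρ` and `R = d₊ g₋ + d₋ g₊` by division with remainder. As no `φᵢ(a)`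
vanishes, `W` and `B` have no common zero, so the zeros of `B` are simple. Each subset of them may
be taken as the zeros of `g₊`; the residues of `R / B` then split between the two half-lines with
the correct signs. This gives `2 ^ deg B` pairs (`encard_setOf_wronskian_eq`). Finally `N - 2 ≤ deg
B ≤ N`, the coefficient of `z ^ N` in `B` is `α` times the leading coefficient of `W`, and when `α =
0` that of `z ^ (N - 1)` is `β` times it. -/

/-! ### The causal kernel and its derivative -/

/-- The causal fundamental solution `2 sinh (t⁺ / 2)` of `-f'' + f / 4`, up to sign. -/
noncomputable def causalKernel (t : ℝ) : ℝ := 2 * Real.sinh (max t 0 / 2)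

theorem causalKernel_of_nonpos {t : ℝ} (h : t ≤ 0) : causalKernel t = 0 := by
  simp [causalKernel, max_eq_right h]

theorem causalKernel_of_nonneg {t : ℝ} (h : 0 ≤ t) :
    causalKernel t = Real.exp (t / 2) - Real.exp (-t / 2) := by
  rw [causalKernel, max_eq_left h, Real.sinh_eq, neg_div]; ring

theorem continuous_causalKernel : Continuous causalKernel := by
  unfold causalKernel; fun_prop

/-- The derivative of `x ↦ causalKernel (y - x)` is minus this function. -/
noncomputable def causalKernelDeriv (y x : ℝ) : ℝ :=
  if x < y then Real.cosh ((y - x) / 2) else 0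

theorem hasDerivAt_causalKernel {x y : ℝ} (h : x ≠ y) :
    HasDerivAt (fun t => causalKernel (y - t)) (-causalKernelDeriv y x) x := by
  rcases lt_or_gt_of_ne h with h | h
  · have h1 : HasDerivAt (fun t : ℝ => 2 * Real.sinh ((y - t) / 2))
        (2 * (Real.cosh ((y - x) / 2) * (-1 / 2))) x :=
      ((((hasDerivAt_id x).const_sub y).div_const 2).sinh).const_mul 2
    have h2 : (fun t => causalKernel (y - t)) =ᶠ[𝓝 x] fun t : ℝ => 2 * Real.sinh ((y - t) / 2) := by
      filter_upwards [eventually_lt_nhds h] with t ht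
      rw [causalKernel, max_eq_left (by linarith)]
    refine (h1.congr_of_eventuallyEq h2).congr_deriv ?_
    rw [causalKernelDeriv, if_pos h]; ring
  · have h2 : (fun t => causalKernel (y - t)) =ᶠ[𝓝 x] fun t : ℝ => 0 := by
      filter_upwards [eventually_gt_nhds h] with t ht
      exact causalKernel_of_nonpos (by linarith)
    refine ((hasDerivAt_const x (0 : ℝ)).congr_of_eventuallyEq h2).congr_deriv ?_
    rw [causalKernelDeriv, if_neg (not_lt.2 h.le), neg_zero]

theorem hasDerivAt_causalKernelDeriv {x y : ℝ} (h : x ≠ y) :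
    HasDerivAt (causalKernelDeriv y) (-causalKernel (y - x) / 4) x := by
  rcases lt_or_gt_of_ne h with h | h
  · have h1 : HasDerivAt (fun t : ℝ => Real.cosh ((y - t) / 2))
        ((Real.sinh ((y - x) / 2) * (-1 / 2))) x :=
      ((((hasDerivAt_id x).const_sub y).div_const 2).cosh)
    have h2 : causalKernelDeriv y =ᶠ[𝓝 x] fun t : ℝ => Real.cosh ((y - t) / 2) := by
      filter_upwards [eventually_lt_nhds h] with t ht
      rw [causalKernelDeriv, if_pos ht]
    refine (h1.congr_of_eventuallyEq h2).congr_deriv ?_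
    rw [causalKernel, max_eq_left (by linarith)]; ring
  · have h2 : causalKernelDeriv y =ᶠ[𝓝 x] fun t : ℝ => 0 := by
      filter_upwards [eventually_gt_nhds h] with t ht
      rw [causalKernelDeriv, if_neg (not_lt.2 ht.le)]
    refine ((hasDerivAt_const x (0 : ℝ)).congr_of_eventuallyEq h2).congr_deriv ?_
    rw [causalKernel_of_nonpos (by linarith)]; simp

/-- The strict inequality in `causalKernelDeriv` makes it right-continuous; its unit jump at `x =
y`, seen only from the left, produces the jump condition for solutions. -/
theorem tendsto_causalKernelDeriv_left (y x : ℝ) :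
    Tendsto (causalKernelDeriv y) (𝓝[<] x)
      (𝓝 (causalKernelDeriv y x + if x = y then 1 else 0)) := by
  rcases le_or_gt x y with h | h
  · have h1 : Tendsto (fun t : ℝ => Real.cosh ((y - t) / 2)) (𝓝[<] x)
        (𝓝 (Real.cosh ((y - x) / 2))) :=
      (Continuous.tendsto (by fun_prop) x).mono_left nhdsWithin_le_nhds
    have h2 : causalKernelDeriv y x + (if x = y then 1 else 0) = Real.cosh ((y - x) / 2) := by
      rcases h.eq_or_lt with rfl | h
      · simp [causalKernelDeriv]
      · simp [causalKernelDeriv, h, h.ne]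
    rw [h2]
    refine h1.congr' ?_
    filter_upwards [self_mem_nhdsWithin] with t ht
    rw [causalKernelDeriv, if_pos (lt_of_lt_of_le ht h)]
  · rw [causalKernelDeriv, if_neg (not_lt.2 h.le), if_neg h.ne', add_zero]
    refine tendsto_const_nhds.congr' ?_
    filter_upwards [nhdsWithin_le_nhds (eventually_gt_nhds h)] with t ht
    rw [causalKernelDeriv, if_neg (not_lt.2 (le_of_lt ht))]

theorem tendsto_causalKernelDeriv_right (y x : ℝ) :
    Tendsto (causalKernelDeriv y) (𝓝[>] x) (𝓝 (causalKernelDeriv y x)) := by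
  rcases lt_or_ge x y with h | h
  · exact ((hasDerivAt_causalKernelDeriv h.ne).continuousAt.tendsto).mono_left nhdsWithin_le_nhds
  · rw [causalKernelDeriv, if_neg (not_lt.2 h)]
    refine tendsto_const_nhds.congr' ?_
    filter_upwards [self_mem_nhdsWithin] with t ht
    rw [causalKernelDeriv, if_neg (not_lt.2 (h.trans (le_of_lt ht)))]

/-! ### Solutions of the differential equation as solutions of a discrete Volterra equation -/

theorem eq_of_hasDerivAt_zero_off_finset {U : ℝ → ℂ} (hU : Continuous U) (S : Finset ℝ)
    (h : ∀ x ∉ S, HasDerivAt U 0 x) (x y : ℝ) : U x = U y := by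
  have := MeasureTheory.integral_eq_of_hasDerivAt_off_countable (a := y) (b := x) U
    (fun _ => 0) (s := S) S.countable_toSet hU.continuousOn
    (fun t ht => h t (by simpa using ht.2)) (by simp)
  simp only [intervalIntegral.integral_zero] at this
  exact (sub_eq_zero.1 this.symm)

/-- The value at `y` of the potential `z ω + z² v`. -/
noncomputable def weight (p : MeasurePair) (z : ℂ) (y : ℝ) : ℂ :=
  z * ((p.1 y : ℝ) : ℂ) + z ^ 2 * (((p.2 y : ℝ≥0) : ℝ) : ℂ)

theorem IsSolution.of_integral_eq {p : MeasurePair} {z : ℂ} {f : ℝ → ℂ} {A B : ℂ}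
    (h : ∀ x : ℝ, f x = A * (Real.exp (-x / 2) : ℝ) + B * (Real.exp (x / 2) : ℝ) -
      ∑ y ∈ p.points, (causalKernel (y - x) : ℂ) * weight p z y * f y) :
    IsSolution p z f := by
  -- The formal derivative of the right-hand side. It is right-continuous everywhere, so its value
  -- at a mass point is the right limit of `f'`.
  set D : ℝ → ℂ := fun x => A * (Real.exp (-x / 2) * (-1 / 2) : ℝ) +
    B * (Real.exp (x / 2) * (1 / 2) : ℝ) +
      ∑ y ∈ p.points, (causalKernelDeriv y x : ℂ) * weight p z y * f y with hD
  have hm : ∀ x : ℝ, HasDerivAt (fun x : ℝ => Real.exp (-x / 2)) (Real.exp (-x / 2) * (-1 / 2)) x :=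
    fun x => (((hasDerivAt_id x).neg).div_const 2).exp
  have hp : ∀ x : ℝ, HasDerivAt (fun x : ℝ => Real.exp (x / 2)) (Real.exp (x / 2) * (1 / 2)) x :=
    fun x => ((hasDerivAt_id x).div_const 2).exp
  have hf : f = fun x : ℝ => A * (Real.exp (-x / 2) : ℝ) + B * (Real.exp (x / 2) : ℝ) -
      ∑ y ∈ p.points, (causalKernel (y - x) : ℂ) * weight p z y * f y := funext h
  have hd : ∀ x ∉ p.points, HasDerivAt f (D x) x := by
    intro x hx
    have h1 : HasDerivAt (fun x : ℝ => ∑ y ∈ p.points,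
        (causalKernel (y - x) : ℂ) * weight p z y * f y)
        (∑ y ∈ p.points, ((-causalKernelDeriv y x : ℝ) : ℂ) * weight p z y * f y) x := by
      refine HasDerivAt.fun_sum fun y hy => ?_
      exact (((hasDerivAt_causalKernel
        (ne_of_mem_of_not_mem hy hx).symm).ofReal_comp).mul_const _).mul_const _
    rw [hf]
    refine ((((hm x).ofReal_comp.const_mul A).fun_add
      ((hp x).ofReal_comp.const_mul B)).fun_sub h1).congr_deriv ?_
    simp [hD, Finset.sum_neg_distrib]
  have hopen : ∀ x ∉ p.points, ∀ᶠ t in 𝓝 x, t ∉ p.points := fun x hx =>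
    p.points.finite_toSet.isClosed.isOpen_compl.mem_nhds (by simpa using hx)
  have hne : ∀ x : ℝ, ∀ᶠ t in 𝓝[≠] x, t ∉ p.points := by
    intro x
    have := (p.points.erase x).finite_toSet.isClosed.isOpen_compl.mem_nhds
      (x := x) (by simp)
    filter_upwards [nhdsWithin_le_nhds this, self_mem_nhdsWithin] with t ht ht' hmem
    exact ht (Finset.mem_coe.2 (Finset.mem_erase.2 ⟨ht', hmem⟩))
  have hcont : Continuous f := by
    rw [hf]
    have := continuous_causalKernel
    fun_prop
  refine ⟨hcont, fun x hx => (hd x hx).differentiableAt, fun x hx => ?_, fun x hx => ?_⟩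
  · have h0 : deriv f =ᶠ[𝓝 x] D := by
      filter_upwards [hopen x hx] with t ht using (hd t ht).deriv
    have h1 : HasDerivAt (fun x : ℝ => ∑ y ∈ p.points,
        (causalKernelDeriv y x : ℂ) * weight p z y * f y)
        (∑ y ∈ p.points, ((-causalKernel (y - x) / 4 : ℝ) : ℂ) * weight p z y * f y) x := by
      refine HasDerivAt.fun_sum fun y hy => ?_
      exact (((hasDerivAt_causalKernelDeriv
        (ne_of_mem_of_not_mem hy hx).symm).ofReal_comp).mul_const _).mul_const _
    have h2 := ((((hm x).mul_const (-1 / 2)).ofReal_comp.const_mul A).fun_add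
      (((hp x).mul_const (1 / 2)).ofReal_comp.const_mul B)).fun_add h1
    refine HasDerivAt.congr_of_eventuallyEq (h2.congr_deriv ?_) h0
    rw [h x]
    push_cast
    simp only [add_div, Finset.sum_div, sub_eq_add_neg, ← Finset.sum_neg_distrib]
    congr 1
    · ring
    · exact Finset.sum_congr rfl fun y _ => by ring
  · refine ⟨D x + weight p z x * f x, D x, ?_, ?_, by simp [weight]; ring⟩
    · have h1 : Tendsto D (𝓝[<] x) (𝓝 (A * (Real.exp (-x / 2) * (-1 / 2) : ℝ) +
          B * (Real.exp (x / 2) * (1 / 2) : ℝ) + ∑ y ∈ p.points,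
            ((causalKernelDeriv y x + if x = y then 1 else 0 : ℝ) : ℂ) * weight p z y * f y)) := by
        refine Tendsto.add ?_ (tendsto_finsetSum _ fun y _ => ?_)
        · exact (Continuous.tendsto (by fun_prop) x).mono_left nhdsWithin_le_nhds
        · exact (((Complex.continuous_ofReal.tendsto _).comp
            (tendsto_causalKernelDeriv_left y x)).mul_const _).mul_const _
      convert h1.congr' ?_ using 2
      · have : ∀ y : ℝ,
          ((causalKernelDeriv y x + if x = y then 1 else 0 : ℝ) : ℂ) * weight p z y * f y
          = (causalKernelDeriv y x : ℂ) * weight p z y * f y +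
            if x = y then weight p z y * f y else 0 := by
          intro y; split_ifs <;> push_cast <;> ring
        simp only [this, Finset.sum_add_distrib, Finset.sum_ite_eq, if_pos hx, hD]
        ring
      · filter_upwards [nhdsWithin_mono x (fun t (ht : t < x) => ht.ne) (hne x)] with t ht
        exact (hd t ht).deriv.symm
    · have h1 : Tendsto D (𝓝[>] x) (𝓝 (D x)) := by
        refine Tendsto.add ?_ (tendsto_finsetSum _ fun y _ => ?_)
        · exact (Continuous.tendsto (by fun_prop) x).mono_left nhdsWithin_le_nhds
        · exact (((Complex.continuous_ofReal.tendsto _).comp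
            (tendsto_causalKernelDeriv_right y x)).mul_const _).mul_const _
      refine h1.congr' ?_
      filter_upwards [nhdsWithin_mono x (fun t (ht : x < t) => ht.ne') (hne x)] with t ht
      exact (hd t ht).deriv.symm

/-- Adding the kernel sum to `f` cancels all jumps of the derivative. The resulting `F` has a
continuous derivative `h` with `h' = F / 4` off the points, so `e^{-x/2} (h + F/2)` and `e^{x/2} (h
- F/2)` are constant. -/
theorem IsSolution.exists_integral_eq {p : MeasurePair} {z : ℂ} {f : ℝ → ℂ}
    (hf : IsSolution p z f) :
    ∃ A B : ℂ, ∀ x : ℝ, f x = A * (Real.exp (-x / 2) : ℝ) + B * (Real.exp (x / 2) : ℝ) -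
      ∑ y ∈ p.points, (causalKernel (y - x) : ℂ) * weight p z y * f y := by
  -- `r x` is the right limit of `f'` at a mass point and `deriv f x` elsewhere, which avoids the
  -- meaningless value of `deriv f` at a kink.
  have hjump : ∀ x : ℝ, ∃ dr : ℂ, (x ∈ p.points →
      Tendsto (deriv f) (𝓝[<] x) (𝓝 (dr + weight p z x * f x)) ∧
      Tendsto (deriv f) (𝓝[>] x) (𝓝 dr)) ∧ (x ∉ p.points → dr = deriv f x) := by
    intro x
    by_cases hx : x ∈ p.points
    · obtain ⟨dl, dr, h1, h2, h3⟩ := hf.jump x hx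
      refine ⟨dr, fun _ => ⟨?_, h2⟩, fun h => absurd hx h⟩
      convert h1 using 2
      rw [h3, weight]; ring
    · exact ⟨deriv f x, fun h => absurd h hx, fun _ => rfl⟩
  choose r hr hr' using hjump
  have hopen : ∀ x ∉ p.points, ∀ᶠ t in 𝓝 x, t ∉ p.points := fun x hx =>
    p.points.finite_toSet.isClosed.isOpen_compl.mem_nhds (by simpa using hx)
  have hne : ∀ x : ℝ, ∀ᶠ t in 𝓝[≠] x, t ∉ p.points := by
    intro x
    have := (p.points.erase x).finite_toSet.isClosed.isOpen_compl.mem_nhds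
      (x := x) (by simp)
    filter_upwards [nhdsWithin_le_nhds this, self_mem_nhdsWithin] with t ht ht' hmem
    exact ht (Finset.mem_coe.2 (Finset.mem_erase.2 ⟨ht', hmem⟩))
  set F : ℝ → ℂ := fun x => f x + ∑ y ∈ p.points,
    (causalKernel (y - x) : ℂ) * weight p z y * f y with hF
  set h : ℝ → ℂ := fun x => r x - ∑ y ∈ p.points,
    (causalKernelDeriv y x : ℂ) * weight p z y * f y with hh
  have hFc : Continuous F := by
    have h1 := continuous_causalKernel
    have h2 := hf.continuous
    fun_prop
  have hFd : ∀ x ∉ p.points, HasDerivAt F (h x) x := by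
    intro x hx
    have h1 : HasDerivAt (fun x : ℝ => ∑ y ∈ p.points,
        (causalKernel (y - x) : ℂ) * weight p z y * f y)
        (∑ y ∈ p.points, ((-causalKernelDeriv y x : ℝ) : ℂ) * weight p z y * f y) x := by
      refine HasDerivAt.fun_sum fun y hy => ?_
      exact (((hasDerivAt_causalKernel
        (ne_of_mem_of_not_mem hy hx).symm).ofReal_comp).mul_const _).mul_const _
    refine ((hf.differentiableAt x hx).hasDerivAt.fun_add h1).congr_deriv ?_
    simp [hh, hr' x hx, Finset.sum_neg_distrib, sub_eq_add_neg]
  have hhd : ∀ x ∉ p.points, HasDerivAt h (F x / 4) x := by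
    intro x hx
    have h1 : HasDerivAt (fun x : ℝ => ∑ y ∈ p.points,
        (causalKernelDeriv y x : ℂ) * weight p z y * f y)
        (∑ y ∈ p.points, ((-causalKernel (y - x) / 4 : ℝ) : ℂ) * weight p z y * f y) x := by
      refine HasDerivAt.fun_sum fun y hy => ?_
      exact (((hasDerivAt_causalKernelDeriv
        (ne_of_mem_of_not_mem hy hx).symm).ofReal_comp).mul_const _).mul_const _
    have h2 : r =ᶠ[𝓝 x] deriv f := by
      filter_upwards [hopen x hx] with t ht using hr' t ht
    refine (((hf.ode x hx).congr_of_eventuallyEq h2).fun_sub h1).congr_deriv ?_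
    simp only [hF, add_div, sub_eq_add_neg, Finset.sum_div, ← Finset.sum_neg_distrib]
    congr 1
    exact Finset.sum_congr rfl fun y _ => by push_cast; ring
  have hhc : Continuous h := by
    rw [continuous_iff_continuousAt]
    intro x
    by_cases hx : x ∈ p.points
    swap
    · exact (hhd x hx).continuousAt
    rw [continuousAt_iff_continuous_left'_right']
    constructor
    · have h1 : Tendsto (fun t => deriv f t - ∑ y ∈ p.points,
          (causalKernelDeriv y t : ℂ) * weight p z y * f y) (𝓝[<] x)
          (𝓝 ((r x + weight p z x * f x) - ∑ y ∈ p.points,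
            ((causalKernelDeriv y x + if x = y then 1 else 0 : ℝ) : ℂ) * weight p z y * f y)) := by
        refine ((hr x hx).1).sub (tendsto_finsetSum _ fun y _ => ?_)
        exact (((Complex.continuous_ofReal.tendsto _).comp
            (tendsto_causalKernelDeriv_left y x)).mul_const _).mul_const _
      unfold ContinuousWithinAt
      convert h1.congr' ?_ using 2
      · have : ∀ y : ℝ,
          ((causalKernelDeriv y x + if x = y then 1 else 0 : ℝ) : ℂ) * weight p z y * f y
          = (causalKernelDeriv y x : ℂ) * weight p z y * f y +
            if x = y then weight p z y * f y else 0 := by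
          intro y; split_ifs <;> push_cast <;> ring
        simp only [this, Finset.sum_add_distrib, Finset.sum_ite_eq, if_pos hx, hh]
        ring
      · filter_upwards [nhdsWithin_mono x (fun t (ht : t < x) => ht.ne) (hne x)] with t ht
        simp only [hr' t ht]
    · have h1 : Tendsto (fun t => deriv f t - ∑ y ∈ p.points,
          (causalKernelDeriv y t : ℂ) * weight p z y * f y) (𝓝[>] x) (𝓝 (h x)) := by
        refine ((hr x hx).2).sub (tendsto_finsetSum _ fun y _ => ?_)
        exact (((Complex.continuous_ofReal.tendsto _).comp
            (tendsto_causalKernelDeriv_right y x)).mul_const _).mul_const _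
      refine h1.congr' ?_
      filter_upwards [nhdsWithin_mono x (fun t (ht : x < t) => ht.ne') (hne x)] with t ht
      simp only [hh, hr' t ht]
  have hm : ∀ x : ℝ, HasDerivAt (fun x : ℝ => Real.exp (-x / 2)) (Real.exp (-x / 2) * (-1 / 2)) x :=
    fun x => (((hasDerivAt_id x).neg).div_const 2).exp
  have hp : ∀ x : ℝ, HasDerivAt (fun x : ℝ => Real.exp (x / 2)) (Real.exp (x / 2) * (1 / 2)) x :=
    fun x => ((hasDerivAt_id x).div_const 2).exp
  have hU := eq_of_hasDerivAt_zero_off_finset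
    (U := fun x => ((Real.exp (-x / 2) : ℝ) : ℂ) * (h x + F x / 2)) (by fun_prop) p.points
    (fun x hx => by
      refine ((hm x).ofReal_comp.fun_mul
        ((hhd x hx).fun_add ((hFd x hx).div_const 2))).congr_deriv ?_
      push_cast; ring)
  have hV := eq_of_hasDerivAt_zero_off_finset
    (U := fun x => ((Real.exp (x / 2) : ℝ) : ℂ) * (h x - F x / 2)) (by fun_prop) p.points
    (fun x hx => by
      refine ((hp x).ofReal_comp.fun_mul
        ((hhd x hx).fun_sub ((hFd x hx).div_const 2))).congr_deriv ?_
      push_cast; ring)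
  refine ⟨-(h 0 - F 0 / 2), h 0 + F 0 / 2, fun x => ?_⟩
  have e1 := hU x 0
  have e2 := hV x 0
  simp only [neg_zero, zero_div, Real.exp_zero, Complex.ofReal_one, one_mul] at e1 e2
  have e3 : ((Real.exp (-x / 2) : ℝ) : ℂ) * ((Real.exp (x / 2) : ℝ) : ℂ) = 1 := by
    rw [← Complex.ofReal_mul, ← Real.exp_add]; simp [neg_div]
  rw [eq_sub_iff_add_eq, ← e1, ← e2]
  change F x = _
  linear_combination -F x * e3

/-! ### Discrete Volterra equations over a ring -/

/-- Only points to the right of `x` enter the equation at `x`, so induction on their number applies.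
-/
theorem volterra_unique {α R : Type*} [LinearOrder α] [Ring R] (S : Finset α) (K : α → α → R)
    (hK : ∀ x y, y ≤ x → K x y = 0) (h : α → R) (hh : ∀ x, h x = ∑ y ∈ S, K x y * h y) (x : α) :
    h x = 0 := by
  induction hn : (S.filter (x < ·)).card using Nat.strong_induction_on generalizing x with
  | _ n ih =>
    rw [hh]
    refine Finset.sum_eq_zero fun y hy => ?_
    rcases le_or_gt y x with hyx | hyx
    · rw [hK x y hyx, zero_mul]
    · rw [ih _ ?_ y rfl, mul_zero]
      rw [← hn]
      refine Finset.card_lt_card (Finset.ssubset_iff_of_subset ?_ |>.2 ⟨y, ?_, ?_⟩)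
      · intro t ht
        simp only [Finset.mem_filter] at ht ⊢
        exact ⟨ht.1, hyx.trans ht.2⟩
      · simp [hy, hyx]
      · simp

theorem volterra_unique_of_le {α R : Type*} [LinearOrder α] [Ring R] (S : Finset α)
    (K : α → α → R) (hK : ∀ x y, x ≤ y → K x y = 0) (h : α → R)
    (hh : ∀ x, h x = ∑ y ∈ S, K x y * h y) (x : α) : h x = 0 :=
  volterra_unique (α := αᵒᵈ) S K hK h hh x

/-- Points are added from right to left: a new smallest point `a` changes `f` by `K x a * f a`,
which vanishes at all earlier points and at `a` itself. An arbitrary ring is allowed so that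
coefficients can be polynomials in `z`. -/
theorem volterra_exists {α R : Type*} [LinearOrder α] [Ring R] (S : Finset α) (K : α → α → R)
    (hK : ∀ x y, y ≤ x → K x y = 0) (e : α → R) :
    ∃ f : α → R, ∀ x, f x = e x + ∑ y ∈ S, K x y * f y := by
  induction S using Finset.induction_on_min with
  | empty => exact ⟨e, by simp⟩
  | insert a s ha ih =>
    obtain ⟨f, hf⟩ := ih
    refine ⟨fun x => f x + K x a * f a, fun x => ?_⟩
    rw [Finset.sum_insert fun h => lt_irrefl _ (ha a h)]
    simp only [hK a a le_rfl]
    have : ∑ y ∈ s, K x y * (f y + K y a * f a) = ∑ y ∈ s, K x y * f y :=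
      Finset.sum_congr rfl fun y hy => by rw [hK y a (ha y hy).le]; simp
    rw [this, hf x]
    rw [zero_mul, add_zero]; abel

/-! ### The solution `φ₊` as a polynomial in `z` -/

theorem causalKernel_sub (x y : ℝ) :
    causalKernel (y - x) = Real.exp (-x / 2) * Real.exp (y / 2) - Real.exp (-|x - y| / 2) := by
  rw [← Real.exp_add]
  rcases le_total x y with h | h
  · rw [causalKernel_of_nonneg (by linarith), abs_of_nonpos (by linarith)]
    congr 2 <;> ring
  · rw [causalKernel_of_nonpos (by linarith), abs_of_nonneg (by linarith), eq_comm, sub_eq_zero]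
    congr 1; ring

/-- The polynomial `ω({y}) + v({y}) z` in `z`. -/
noncomputable def density (p : MeasurePair) (y : ℝ) : ℝ[X] := C (p.1 y) + C ((p.2 y : ℝ≥0) : ℝ) * X

theorem aeval_X_mul_density (p : MeasurePair) (z : ℂ) (y : ℝ) :
    aeval z (X * density p y) = weight p z y := by
  simp [density, weight]; ring

theorem density_eq_zero_iff {p : MeasurePair} {y : ℝ} : density p y = 0 ↔ y ∉ p.points := by
  constructor
  · intro h
    have h0 := congrArg (coeff · 0) h
    have h1 := congrArg (coeff · 1) h
    simp [density, coeff_C] at h0 h1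
    simp [MeasurePair.points, h0, h1]
  · intro h
    simp [MeasurePair.points] at h
    simp [density, h.1, h.2]

theorem density_inj {p q : MeasurePair} {x y : ℝ} (h : density p x = density q y) :
    p.1 x = q.1 y ∧ p.2 x = q.2 y := by
  have h0 := congrArg (coeff · 0) h
  have h1 := congrArg (coeff · 1) h
  simp [density, coeff_C] at h0 h1
  exact ⟨h0, h1⟩

theorem exists_phi (p : MeasurePair) : ∃ f : ℝ → ℝ[X], ∀ x, f x = C (Real.exp (-x / 2)) +
    ∑ y ∈ p.points, (-C (causalKernel (y - x)) * (X * density p y)) * f y :=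
  volterra_exists _ _ (fun x y h => by rw [causalKernel_of_nonpos (by linarith)]; simp) _

/-- The solution `φ₊(z, x)` as a polynomial in `z`. -/
noncomputable def phi (p : MeasurePair) : ℝ → ℝ[X] := (exists_phi p).choose

theorem phi_eq (p : MeasurePair) (x : ℝ) : phi p x = C (Real.exp (-x / 2)) -
    ∑ y ∈ p.points, C (causalKernel (y - x)) * (X * density p y) * phi p y := by
  have := (exists_phi p).choose_spec x
  rw [phi, this]
  simp [sub_eq_add_neg, Finset.sum_neg_distrib]

theorem aeval_phi_eq (p : MeasurePair) (z : ℂ) (x : ℝ) : aeval z (phi p x) =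
    (Real.exp (-x / 2) : ℝ) -
      ∑ y ∈ p.points, (causalKernel (y - x) : ℂ) * weight p z y * aeval z (phi p y) := by
  conv_lhs => rw [phi_eq]
  rw [map_sub, map_sum, aeval_C]
  congr 1
  refine Finset.sum_congr rfl fun y _ => ?_
  rw [map_mul, map_mul, aeval_X_mul_density, aeval_C]; rfl

theorem eventually_points_le (p : MeasurePair) : ∀ᶠ x in atTop, ∀ y ∈ p.points, y ≤ x :=
  (Filter.eventually_all_finset _).2 fun y _ => eventually_ge_atTop y

theorem eq_mul_aeval_phi {p : MeasurePair} {z A : ℂ} {f : ℝ → ℂ}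
    (h : ∀ x : ℝ, f x = A * (Real.exp (-x / 2) : ℝ) -
      ∑ y ∈ p.points, (causalKernel (y - x) : ℂ) * weight p z y * f y) (x : ℝ) :
    f x = A * aeval z (phi p x) := by
  rw [← sub_eq_zero]
  refine volterra_unique p.points (fun x y => -(causalKernel (y - x) : ℂ) * weight p z y) ?_
    (fun x => f x - A * aeval z (phi p x)) ?_ x
  · intro x y h
    rw [causalKernel_of_nonpos (by linarith)]; simp
  · intro x
    rw [h x, aeval_phi_eq]
    simp only [mul_sub, Finset.sum_sub_distrib, Finset.mul_sum, neg_mul, Finset.sum_neg_distrib]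
    have : ∑ y ∈ p.points, A * ((causalKernel (y - x) : ℂ) * weight p z y * aeval z (phi p y)) =
        ∑ y ∈ p.points, (causalKernel (y - x) : ℂ) * weight p z y * (A * aeval z (phi p y)) :=
      Finset.sum_congr rfl fun y _ => by ring
    rw [this]; ring

theorem aeval_phi_of_points_le {p : MeasurePair} {x : ℝ} (hx : ∀ y ∈ p.points, y ≤ x) (z : ℂ) :
    aeval z (phi p x) = (Real.exp (-x / 2) : ℝ) := by
  rw [aeval_phi_eq, Finset.sum_eq_zero, sub_zero]
  intro y hy
  rw [causalKernel_of_nonpos (by linarith [hx y hy])]; simp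

theorem isSolution_aeval_phi (p : MeasurePair) (z : ℂ) :
    IsSolution p z fun x => aeval z (phi p x) :=
  IsSolution.of_integral_eq (A := 1) (B := 0) fun x => by rw [aeval_phi_eq]; simp

/-- To the right of all masses the kernel sum vanishes, so the asymptotics say `B e^x = 1 - A`;
comparing `x` with `x + 1` gives `B = 0` and `A = 1`, and Volterra uniqueness does the rest. -/
theorem isPhiPlus_iff {p : MeasurePair} {z : ℂ} {f : ℝ → ℂ} :
    IsPhiPlus p z f ↔ f = fun x => aeval z (phi p x) := by
  constructor
  · rintro ⟨hf, hinf⟩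
    obtain ⟨A, B, h⟩ := hf.exists_integral_eq
    have key : ∀ᶠ x : ℝ in atTop, B * (Real.exp x : ℝ) = 1 - A := by
      filter_upwards [hinf, eventually_points_le p] with x h1 h2
      have h3 := h x
      rw [Finset.sum_eq_zero, sub_zero, h1] at h3
      · have e : ((Real.exp (-x / 2) : ℝ) : ℂ) * (Real.exp (x / 2) : ℝ) = 1 := by
          rw [← Complex.ofReal_mul, ← Real.exp_add]; simp [neg_div]
        have e' : ((Real.exp x : ℝ) : ℂ) = (Real.exp (x / 2) : ℝ) * (Real.exp (x / 2) : ℝ) := by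
          rw [← Complex.ofReal_mul, ← Real.exp_add]; simp
        rw [e']
        linear_combination (1 - A) * e - (Real.exp (x / 2) : ℝ) * h3
      · intro y hy
        rw [causalKernel_of_nonpos (by linarith [h2 y hy])]; simp
    obtain ⟨x, hx⟩ := eventually_atTop.1 key
    have h1 := hx x le_rfl
    have h2 := hx (x + 1) (by linarith)
    have hB : B = 0 := by
      have : B * (((Real.exp (x + 1) - Real.exp x : ℝ)) : ℂ) = 0 := by
        push_cast at h1 h2 ⊢; linear_combination h2 - h1
      refine (mul_eq_zero.1 this).resolve_right ?_
      rw [← ne_eq, Complex.ofReal_ne_zero, sub_ne_zero]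
      exact (Real.exp_lt_exp.2 (by linarith)).ne'
    have hA : A = 1 := by rw [hB, zero_mul] at h1; linear_combination h1
    funext x
    rw [eq_mul_aeval_phi (A := 1) (f := f) (p := p) (z := z)
      (fun x => by rw [h x, hB, hA]; simp) x, one_mul]
  · rintro rfl
    refine ⟨isSolution_aeval_phi p z, ?_⟩
    filter_upwards [eventually_points_le p] with x hx
    exact aeval_phi_of_points_le hx z

/-! ### The Wronskian and the eigenvalues -/

/-- The Wronskian of `φ₊` and `φ₋`, a polynomial in `z`. -/
noncomputable def wronskian (p : MeasurePair) : ℝ[X] :=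
  1 - ∑ y ∈ p.points, C (Real.exp (y / 2)) * (X * density p y) * phi p y

/-- The causal kernel differs from the decaying Green kernel by the rank one term `e^{-x/2}
e^{y/2}`, which collects into the Wronskian. Thus `W` is the coefficient of the growing exponential
of `φ₊` at `-∞`. -/
theorem phi_eq_green (p : MeasurePair) (x : ℝ) : phi p x = C (Real.exp (-x / 2)) * wronskian p +
    ∑ y ∈ p.points, C (Real.exp (-|x - y| / 2)) * (X * density p y) * phi p y := by
  conv_lhs => rw [phi_eq]
  simp only [causalKernel_sub, wronskian, mul_sub, sub_mul, map_sub, map_mul,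
    Finset.sum_sub_distrib, Finset.mul_sum, ← mul_assoc]
  ring

theorem aeval_phi_eq_green (p : MeasurePair) (z : ℂ) (x : ℝ) : aeval z (phi p x) =
    (Real.exp (-x / 2) : ℝ) * aeval z (wronskian p) +
    ∑ y ∈ p.points, ((Real.exp (-|x - y| / 2) : ℝ) : ℂ) * weight p z y * aeval z (phi p y) := by
  conv_lhs => rw [phi_eq_green]
  rw [map_add, map_sum, map_mul, aeval_C]
  congr 1
  refine Finset.sum_congr rfl fun y _ => ?_
  rw [map_mul, map_mul, aeval_X_mul_density, aeval_C]; rfl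

theorem eq_zero_of_mul_exp_le {b c : ℝ} (hb : 0 ≤ b)
    (h : ∀ᶠ x : ℝ in atTop, b * Real.exp (x / 2) ≤ c) : b = 0 := by
  by_contra hne
  have h1 : Tendsto (fun x : ℝ => b * Real.exp (x / 2)) atTop atTop :=
    (Real.tendsto_exp_atTop.comp (tendsto_id.atTop_div_const (by norm_num))).const_mul_atTop
      (lt_of_le_of_ne hb (Ne.symm hne))
  obtain ⟨x, h2, h3⟩ := (h.and (h1.eventually_gt_atTop c)).exists
  linarith

theorem norm_green_sum_le (p : MeasurePair) (z : ℂ) (f : ℝ → ℂ) (x : ℝ) :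
    ‖∑ y ∈ p.points, ((Real.exp (-|x - y| / 2) : ℝ) : ℂ) * weight p z y * f y‖ ≤
      ∑ y ∈ p.points, ‖weight p z y * f y‖ := by
  refine (norm_sum_le _ _).trans (Finset.sum_le_sum fun y _ => ?_)
  rw [mul_assoc, norm_mul]
  refine mul_le_of_le_one_left (norm_nonneg _) ?_
  rw [Complex.norm_real, Real.norm_of_nonneg (Real.exp_pos _).le, Real.exp_le_one_iff]
  have := abs_nonneg (x - y); linarith

/-- Boundedness at `+∞` removes `e^{x/2}`, leaving a multiple of `φ₊`; boundedness at `-∞` then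
removes `W e^{-x/2}`. If `W` vanishes, `φ₊` equals a Green sum, which is bounded. -/
theorem mem_eigenvalues_iff {p : MeasurePair} {z : ℂ} :
    z ∈ eigenvalues p ↔ aeval z (wronskian p) = 0 := by
  constructor
  · rintro ⟨f, hf, hne, M, hM⟩
    obtain ⟨A, B, h⟩ := hf.exists_integral_eq
    have hB : B = 0 := by
      rw [← norm_eq_zero]
      refine eq_zero_of_mul_exp_le (c := M + ‖A‖) (norm_nonneg _) ?_
      filter_upwards [eventually_points_le p, eventually_ge_atTop 0] with x h1 h2
      have h3 := h x
      rw [Finset.sum_eq_zero, sub_zero] at h3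
      · have h4 : B * (Real.exp (x / 2) : ℝ) = f x - A * (Real.exp (-x / 2) : ℝ) := by
          rw [h3]; ring
        calc ‖B‖ * Real.exp (x / 2) = ‖B * (Real.exp (x / 2) : ℝ)‖ := by
              rw [norm_mul, Complex.norm_real, Real.norm_of_nonneg (Real.exp_pos _).le]
          _ ≤ ‖f x‖ + ‖A * (Real.exp (-x / 2) : ℝ)‖ := by rw [h4]; exact norm_sub_le _ _
          _ ≤ M + ‖A‖ := by
              refine add_le_add (hM x) ?_
              rw [norm_mul, Complex.norm_real, Real.norm_of_nonneg (Real.exp_pos _).le]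
              refine mul_le_of_le_one_right (norm_nonneg _) (Real.exp_le_one_iff.2 (by linarith))
      · intro y hy
        rw [causalKernel_of_nonpos (by linarith [h1 y hy])]; simp
    have hfA := eq_mul_aeval_phi (A := A) (f := f) (p := p) (z := z)
      (fun x => by rw [h x, hB]; simp)
    have hA : A ≠ 0 := by
      rintro rfl
      exact hne (funext fun x => by rw [hfA]; simp)
    have hAW : ‖A * aeval z (wronskian p)‖ = 0 := by
      refine eq_zero_of_mul_exp_le
        (c := M + ∑ y ∈ p.points, ‖weight p z y * f y‖) (norm_nonneg _) ?_
      filter_upwards with x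
      have h4 : A * aeval z (wronskian p) * (Real.exp (x / 2) : ℝ) = f (-x) -
          ∑ y ∈ p.points, ((Real.exp (-|(-x) - y| / 2) : ℝ) : ℂ) * weight p z y * f y := by
        rw [hfA, aeval_phi_eq_green, neg_neg]
        simp only [hfA, mul_add, Finset.mul_sum]
        rw [add_sub_assoc, ← Finset.sum_sub_distrib, Finset.sum_eq_zero]
        · ring
        · intro y _; ring
      calc ‖A * aeval z (wronskian p)‖ * Real.exp (x / 2)
          = ‖A * aeval z (wronskian p) * (Real.exp (x / 2) : ℝ)‖ := by
            rw [norm_mul _ ((Real.exp (x / 2) : ℝ) : ℂ), Complex.norm_real,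
              Real.norm_of_nonneg (Real.exp_pos _).le]
        _ ≤ _ := by
            rw [h4]
            exact (norm_sub_le _ _).trans (add_le_add (hM _) (norm_green_sum_le p z f _))
    exact (mul_eq_zero.1 (norm_eq_zero.1 hAW)).resolve_left hA
  · intro hW
    refine ⟨_, isSolution_aeval_phi p z, ?_, ∑ y ∈ p.points, ‖weight p z y * aeval z (phi p y)‖,
      fun x => ?_⟩
    · obtain ⟨x, hx⟩ := (eventually_points_le p).exists
      intro h0
      have := congrFun h0 x
      simp only [aeval_phi_of_points_le hx, Pi.zero_apply, Complex.ofReal_eq_zero] at this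
      exact (Real.exp_pos _).ne' this
    · rw [aeval_phi_eq_green, hW, mul_zero, zero_add]
      exact norm_green_sum_le p z (fun y => aeval z (phi p y)) x

/-! ### Reflection, the solution `φ₋`, and norming constants -/

/-- The image of a pair of measures under `x ↦ -x`. -/
noncomputable def MeasurePair.reflect (p : MeasurePair) : MeasurePair :=
  (p.1.equivMapDomain (Equiv.neg ℝ), p.2.equivMapDomain (Equiv.neg ℝ))

theorem reflect_fst (p : MeasurePair) (x : ℝ) : p.reflect.1 x = p.1 (-x) := rfl

theorem reflect_snd (p : MeasurePair) (x : ℝ) : p.reflect.2 x = p.2 (-x) := rfl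

theorem density_reflect (p : MeasurePair) (x : ℝ) : density p.reflect x = density p (-x) := rfl

theorem mem_points_reflect {p : MeasurePair} {x : ℝ} : x ∈ p.reflect.points ↔ -x ∈ p.points := by
  rw [← not_iff_not, ← density_eq_zero_iff, ← density_eq_zero_iff, density_reflect]

theorem sum_points_reflect {M : Type*} [AddCommMonoid M] (p : MeasurePair) (F : ℝ → M) :
    ∑ y ∈ p.reflect.points, F y = ∑ y ∈ p.points, F (-y) := by
  refine Finset.sum_bij' (fun y _ => -y) (fun y _ => -y) ?_ ?_ ?_ ?_ ?_ <;>
    simp +contextual [mem_points_reflect]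

/-- The solution `φ₋(z, x)`, equal to `e^{x/2}` near `-∞`, as a polynomial in `z`. -/
noncomputable def phiMinus (p : MeasurePair) (x : ℝ) : ℝ[X] := phi p.reflect (-x)

theorem phiMinus_eq (p : MeasurePair) (x : ℝ) : phiMinus p x = C (Real.exp (x / 2)) -
    ∑ y ∈ p.points, C (causalKernel (x - y)) * (X * density p y) * phiMinus p y := by
  rw [phiMinus, phi_eq, sum_points_reflect, neg_neg]
  congr 1
  refine Finset.sum_congr rfl fun y _ => ?_
  rw [density_reflect, neg_neg, phiMinus, show -y - -x = x - y by ring]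

theorem aeval_ofReal (P : ℝ[X]) (r : ℝ) : aeval (r : ℂ) P = ((P.eval r : ℝ) : ℂ) :=
  aeval_algebraMap_apply_eq_algebraMap_eval r P

theorem gammaSq_phi (p : MeasurePair) (r : ℝ) :
    gammaSq p r (fun x => aeval (r : ℂ) (phi p x)) =
      ∑ y ∈ p.points, (derivative (X * density p y)).eval r * ((phi p y).eval r) ^ 2 := by
  rw [gammaSq, Finsupp.sum_of_support_subset (s := p.points) _ Finset.subset_union_left _ (by simp),
    Finsupp.sum_of_support_subset (s := p.points) _ Finset.subset_union_right _ (by simp),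
    Finset.mul_sum, ← Finset.sum_add_distrib]
  refine Finset.sum_congr rfl fun y _ => ?_
  rw [aeval_ofReal, Complex.norm_real, Real.norm_eq_abs, sq_abs]
  simp [density]; ring

/-- The coefficient of `e^{x/2}` in `φ₊(r, x)` near `-∞`. -/
noncomputable def couplingConst (p : MeasurePair) (r : ℝ) : ℝ :=
  ∑ y ∈ p.points, Real.exp (-y / 2) * (X * density p y).eval r * (phi p y).eval r

/-- Without the Wronskian term, the Green sum can be rewritten with the kernel causal from the left,
which gives the Volterra equation of a multiple of `φ₋`. -/
theorem eval_phi_eq_coupling {p : MeasurePair} {r : ℝ} (hr : (wronskian p).eval r = 0) (x : ℝ) :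
    (phi p x).eval r = couplingConst p r * (phiMinus p x).eval r := by
  have hphi : ∀ x, (phi p x).eval r = couplingConst p r * Real.exp (x / 2) -
      ∑ y ∈ p.points, causalKernel (x - y) * (X * density p y).eval r * (phi p y).eval r := by
    intro x
    conv_lhs => rw [phi_eq_green]
    simp only [eval_add, eval_mul, eval_C, hr, mul_zero, zero_add, eval_finsetSum, couplingConst,
      Finset.sum_mul, ← Finset.sum_sub_distrib]
    refine Finset.sum_congr rfl fun y _ => ?_
    rw [causalKernel_sub, abs_sub_comm]; ring
  rw [← sub_eq_zero]
  refine volterra_unique_of_le p.points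
    (fun x y => -causalKernel (x - y) * (X * density p y).eval r) ?_
    (fun x => (phi p x).eval r - couplingConst p r * (phiMinus p x).eval r) ?_ x
  · intro x y h
    rw [causalKernel_of_nonpos (by linarith)]; simp
  · intro x
    conv_lhs => rw [hphi x, phiMinus_eq]
    simp only [eval_sub, eval_finsetSum, eval_mul, eval_C, mul_sub, Finset.sum_sub_distrib,
      Finset.mul_sum, neg_mul, Finset.sum_neg_distrib]
    have : ∀ y : ℝ, couplingConst p r * (causalKernel (x - y) * (eval r X * eval r (density p y)) *
        eval r (phiMinus p y)) = causalKernel (x - y) * (eval r X * eval r (density p y)) *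
        (couplingConst p r * eval r (phiMinus p y)) := fun y => by ring
    simp only [this]; ring

theorem couplingConst_ne_zero {p : MeasurePair} {r : ℝ} (hr : (wronskian p).eval r = 0) :
    couplingConst p r ≠ 0 := by
  intro h0
  obtain ⟨x, hx⟩ := (eventually_points_le p).exists
  have h1 := aeval_phi_of_points_le hx (r : ℂ)
  rw [aeval_ofReal, eval_phi_eq_coupling hr, h0, zero_mul, Complex.ofReal_inj] at h1
  exact (Real.exp_pos _).ne h1

/-- The Green equation is differentiated in `z` at a zero of `W` and paired with `m u`. By symmetry
of the Green kernel the terms with `u'` cancel, leaving `c W' + ∑ m' u² = 0`; here `m' = ω + 2 r v`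
is the density in `γ²`. -/
theorem derivative_wronskian_mul_couplingConst {p : MeasurePair} {r : ℝ}
    (hr : (wronskian p).eval r = 0) :
    (derivative (wronskian p)).eval r * couplingConst p r =
      -gammaSq p r (fun x => aeval (r : ℂ) (phi p x)) := by
  rw [gammaSq_phi]
  set m : ℝ → ℝ := fun y => (X * density p y).eval r with hm
  set m' : ℝ → ℝ := fun y => (derivative (X * density p y)).eval r with hm'
  set u : ℝ → ℝ := fun y => (phi p y).eval r with hu
  set u' : ℝ → ℝ := fun y => (derivative (phi p y)).eval r with hu'
  set E : ℝ → ℝ → ℝ := fun x y => Real.exp (-|x - y| / 2) with hE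
  set w := (derivative (wronskian p)).eval r with hw
  have h1 : ∀ x, u x = ∑ y ∈ p.points, E x y * m y * u y := by
    intro x
    simp only [hu]
    rw [phi_eq_green]
    simp only [eval_add, eval_mul, eval_C, hr, mul_zero, zero_add, eval_finsetSum, hm, hE]
  have h2 : ∀ x, u' x = Real.exp (-x / 2) * w +
      ∑ y ∈ p.points, E x y * (m' y * u y + m y * u' y) := by
    intro x
    simp only [hu']
    rw [phi_eq_green]
    simp only [derivative_add, derivative_mul, derivative_C, derivative_sum, eval_add, eval_mul,
      eval_C, eval_finsetSum, hm, hm', hu, hE, hw, zero_mul, zero_add]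
    congr 1
    exact Finset.sum_congr rfl fun y _ => by ring
  have h3 : ∑ x ∈ p.points, m x * u x * u' x = couplingConst p r * w +
      ∑ y ∈ p.points, m' y * u y ^ 2 + ∑ y ∈ p.points, m y * u y * u' y := by
    calc ∑ x ∈ p.points, m x * u x * u' x
        = ∑ x ∈ p.points, (Real.exp (-x / 2) * m x * u x * w +
          ∑ y ∈ p.points, m x * u x * (E x y * (m' y * u y + m y * u' y))) := by
          refine Finset.sum_congr rfl fun x _ => ?_
          rw [h2 x, mul_add, Finset.mul_sum]; ring
      _ = couplingConst p r * w + ∑ y ∈ p.points, ∑ x ∈ p.points,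
            m x * u x * (E x y * (m' y * u y + m y * u' y)) := by
          rw [Finset.sum_add_distrib, ← Finset.sum_mul, couplingConst, Finset.sum_comm]
      _ = couplingConst p r * w + ∑ y ∈ p.points, (m' y * u y + m y * u' y) * u y := by
          congr 1
          refine Finset.sum_congr rfl fun y _ => ?_
          -- As `E` is symmetric, the inner sum over `x` is the Green equation for `u y`.
          have h4 : (m' y * u y + m y * u' y) * u y = (m' y * u y + m y * u' y) *
            ∑ x ∈ p.points, E y x * m x * u x := congrArg _ (h1 y)
          rw [h4, Finset.mul_sum]
          refine Finset.sum_congr rfl fun x _ => ?_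
          simp only [hE, abs_sub_comm y x]; ring
      _ = _ := by
          rw [add_assoc, ← Finset.sum_add_distrib]
          congr 1
          exact Finset.sum_congr rfl fun y _ => by ring
  linear_combination -h3

/-! ### Half-line data and the recursion from one mass point to the next -/

/-- `e^{b/2} φ₊(z, b)` as a polynomial in `z`. -/
noncomputable def halfValue (p : MeasurePair) (b : ℝ) : ℝ[X] := C (Real.exp (b / 2)) * phi p b

/-- The polynomial `d` for which `φ₊'(z, b+) = e^{-b/2} (z d(z) - g(z) / 2)`, where `g` is
`halfValue p b`. -/
noncomputable def halfSlope (p : MeasurePair) (b : ℝ) : ℝ[X] :=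
  ∑ y ∈ p.points with b < y, C (Real.exp (b - y / 2)) * density p y * phi p y

theorem halfValue_eq (p : MeasurePair) (b : ℝ) : halfValue p b = 1 -
    ∑ y ∈ p.points with b < y,
      C (Real.exp (y / 2) - Real.exp (b - y / 2)) * (X * density p y) * phi p y := by
  rw [halfValue, phi_eq, mul_sub, ← C_mul, ← Real.exp_add, Finset.mul_sum, Finset.sum_filter,
    show b / 2 + -b / 2 = 0 by ring, Real.exp_zero, C_1]
  congr 1
  refine Finset.sum_congr rfl fun y _ => ?_
  split_ifs with h
  · rw [causalKernel_of_nonneg (by linarith), ← mul_assoc, ← mul_assoc, ← C_mul, mul_sub,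
      ← Real.exp_add, ← Real.exp_add]
    congr 4 <;> congr 1 <;> ring
  · rw [causalKernel_of_nonpos (by linarith)]; simp

/-- Causality: on `[b, ∞)` the Volterra equation involves only masses strictly to the right of `b`.
-/
theorem phi_congr {p q : MeasurePair} {b : ℝ} (h : ∀ y, b < y → density p y = density q y)
    {x : ℝ} (hx : b ≤ x) : phi p x = phi q x := by
  have hpt : ∀ y, b < y → (y ∈ p.points ↔ y ∈ q.points) := fun y hy => by
    rw [← not_iff_not, ← density_eq_zero_iff, ← density_eq_zero_iff, h y hy]
  have hq : ∀ x, b ≤ x → phi q x = C (Real.exp (-x / 2)) -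
      ∑ y ∈ p.points, C (causalKernel (y - x)) * (X * density p y) * phi q y := by
    intro x hx
    rw [phi_eq]
    congr 1
    have : ∀ (S : Finset ℝ) (r : MeasurePair),
        ∑ y ∈ S, C (causalKernel (y - x)) * (X * density r y) * phi q y
        = ∑ y ∈ S with b < y, C (causalKernel (y - x)) * (X * density r y) * phi q y := by
      intro S r
      rw [Finset.sum_filter]
      refine Finset.sum_congr rfl fun y _ => ?_
      split_ifs with hy
      · rfl
      · rw [causalKernel_of_nonpos (by linarith)]; simp
    rw [this, this p.points]
    refine Finset.sum_congr ?_ fun y hy => ?_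
    · ext y
      simp only [Finset.mem_filter]
      exact ⟨fun hy => ⟨(hpt y hy.2).2 hy.1, hy.2⟩, fun hy => ⟨(hpt y hy.2).1 hy.1, hy.2⟩⟩
    · rw [h y (Finset.mem_filter.1 hy).2]
  -- The difference and the kernel are both cut off to the left of `b`, so that the homogeneous
  -- equation holds for every `x`.
  have := volterra_unique p.points
    (fun x y => if b ≤ x then -C (causalKernel (y - x)) * (X * density p y) else 0)
    (fun x y hxy => by rw [causalKernel_of_nonpos (by linarith)]; simp)
    (fun x => if b ≤ x then phi p x - phi q x else 0) ?_ x
  · rw [if_pos hx] at this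
    exact sub_eq_zero.1 this
  · intro x
    split_ifs with hx
    · conv_lhs => rw [phi_eq, hq x hx]
      rw [sub_sub_sub_cancel_left, ← Finset.sum_sub_distrib]
      refine Finset.sum_congr rfl fun y _ => ?_
      split_ifs with hy
      · ring
      · rw [causalKernel_of_nonpos (by linarith)]; simp
    · simp

theorem half_congr {p q : MeasurePair} {b : ℝ} (h : ∀ y, b < y → density p y = density q y) :
    halfValue p b = halfValue q b ∧ halfSlope p b = halfSlope q b := by
  have hpt : ∀ y, b < y → (y ∈ p.points ↔ y ∈ q.points) := fun y hy => by
    rw [← not_iff_not, ← density_eq_zero_iff, ← density_eq_zero_iff, h y hy]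
  refine ⟨by rw [halfValue, halfValue, phi_congr h le_rfl], ?_⟩
  rw [halfSlope, halfSlope]
  refine Finset.sum_congr ?_ fun y hy => ?_
  · ext y
    simp only [Finset.mem_filter]
    exact ⟨fun hy => ⟨(hpt y hy.2).1 hy.1, hy.2⟩, fun hy => ⟨(hpt y hy.2).2 hy.1, hy.2⟩⟩
  · have hy := (Finset.mem_filter.1 hy).2
    rw [h y hy, phi_congr h hy.le]

theorem half_of_forall_notMem {p : MeasurePair} {b : ℝ} (h : ∀ y, b < y → y ∉ p.points) :
    halfValue p b = 1 ∧ halfSlope p b = 0 := by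
  have : (p.points.filter (b < ·)) = ∅ := by
    ext y; simp; intro h1; by_contra h2; exact h y (not_le.1 h2) h1
  rw [halfValue_eq, halfSlope, this]; simp

theorem filter_points_eq_insert {p : MeasurePair} {b t : ℝ} (hbt : b < t)
    (h : ∀ y, b < y → y < t → y ∉ p.points) (ht : t ∈ p.points) :
    p.points.filter (b < ·) = insert t (p.points.filter (t < ·)) := by
  ext y
  simp only [Finset.mem_filter, Finset.mem_insert]
  constructor
  · rintro ⟨h1, h2⟩
    rcases lt_trichotomy y t with h3 | h3 | h3
    · exact absurd h1 (h y h2 h3)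
    · exact Or.inl h3
    · exact Or.inr ⟨h1, h3⟩
  · rintro (rfl | ⟨h1, h2⟩)
    · exact ⟨ht, hbt⟩
    · exact ⟨h1, hbt.trans h2⟩

/-- Together with `halfValue_step` this is one step of a continued fraction: with `ρ` the density at
the first point `t`, `g / d` at `b` is `-(e^{t-b} - 1) z` plus `e^{t-b}` over `ρ + d / g` at `t`. -/
theorem halfSlope_step {p : MeasurePair} {b t : ℝ} (hbt : b < t)
    (h : ∀ y, b < y → y < t → y ∉ p.points) (ht : t ∈ p.points) :
    halfSlope p b = C (Real.exp (b - t)) * (halfSlope p t + density p t * halfValue p t) := by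
  rw [halfSlope, filter_points_eq_insert hbt h ht, Finset.sum_insert (by simp), add_comm, mul_add,
    halfSlope, halfValue, Finset.mul_sum]
  congr 1
  · refine Finset.sum_congr rfl fun y _ => ?_
    rw [← mul_assoc, ← mul_assoc, ← C_mul, ← Real.exp_add]
    congr 4; ring
  · rw [show C (Real.exp (b - t)) * (density p t * (C (Real.exp (t / 2)) * phi p t)) =
      (C (Real.exp (b - t)) * C (Real.exp (t / 2))) * density p t * phi p t by ring, ← C_mul,
      ← Real.exp_add]
    congr 4; ring

theorem halfValue_step {p : MeasurePair} {b t : ℝ} (hbt : b < t)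
    (h : ∀ y, b < y → y < t → y ∉ p.points) (ht : t ∈ p.points) :
    halfValue p b = halfValue p t - C (Real.exp (t - b) - 1) * X * halfSlope p b := by
  have h1 : ∑ y ∈ p.points with b < y,
      C (Real.exp (y / 2) - Real.exp (t - y / 2)) * (X * density p y) * phi p y =
      ∑ y ∈ p.points with t < y,
      C (Real.exp (y / 2) - Real.exp (t - y / 2)) * (X * density p y) * phi p y := by
    rw [filter_points_eq_insert hbt h ht, Finset.sum_insert (by simp),
      show t - t / 2 = t / 2 by ring]
    simp
  rw [halfValue_eq p t, ← h1, halfValue_eq, halfSlope, Finset.mul_sum, sub_sub,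
    ← Finset.sum_add_distrib]
  congr 1
  refine Finset.sum_congr rfl fun y _ => ?_
  have h2 : Real.exp (t - y / 2) = Real.exp (t - b) * Real.exp (b - y / 2) := by
    rw [← Real.exp_add]; congr 1; ring
  rw [h2]
  simp only [map_sub, map_mul, map_one]
  ring

theorem exists_first_point {p : MeasurePair} {b : ℝ} (h : ¬ ∀ y, b < y → y ∉ p.points) :
    ∃ t ∈ p.points, b < t ∧ ∀ y, b < y → y < t → y ∉ p.points := by
  push Not at h
  obtain ⟨y, hy1, hy2⟩ := h
  have hne : (p.points.filter (b < ·)).Nonempty := ⟨y, by simp [hy1, hy2]⟩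
  have hm := Finset.min'_mem _ hne
  refine ⟨_, (Finset.mem_filter.1 hm).1, (Finset.mem_filter.1 hm).2, fun x h1 h2 h3 => ?_⟩
  exact absurd (Finset.min'_le _ x (Finset.mem_filter.2 ⟨h3, h1⟩)) (not_le.2 h2)

/-! ### Splitting the Wronskian at `a` -/

theorem halfValue_reflect (p : MeasurePair) (a : ℝ) :
    halfValue p.reflect (-a) = C (Real.exp (-a / 2)) * phiMinus p a := by
  rw [halfValue, phiMinus]

theorem X_mul_halfSlope (p : MeasurePair) (a : ℝ) : X * halfSlope p a = C (Real.exp a) *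
    ∑ y ∈ p.points with a < y, C (Real.exp (-y / 2)) * (X * density p y) * phi p y := by
  rw [halfSlope, Finset.mul_sum, Finset.mul_sum]
  refine Finset.sum_congr rfl fun y _ => ?_
  rw [show a - y / 2 = a + -y / 2 by ring, Real.exp_add, C_mul]; ring

theorem X_mul_halfSlope_reflect (p : MeasurePair) (a : ℝ) :
    X * halfSlope p.reflect (-a) = C (Real.exp (-a)) *
    ∑ y ∈ p.points with y < a, C (Real.exp (y / 2)) * (X * density p y) * phiMinus p y := by
  rw [X_mul_halfSlope, Finset.sum_filter, Finset.sum_filter, sum_points_reflect]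
  congr 1
  refine Finset.sum_congr rfl fun y _ => ?_
  simp only [neg_lt_neg_iff, density_reflect, neg_neg, phiMinus]

/-- The pairing `∑ m u w` is expanded once by the equation of `w` and once by that of `u`. The
kernels are transposes of each other, so the two double sums agree and cancel. -/
theorem sum_mul_eq_of_volterra {R : Type*} [CommRing R] (T : Finset ℝ) (m u w e e' : ℝ → R)
    (K : ℝ → ℝ → R) (A B : R)
    (hu : ∀ x ∈ T, u x = e' x * A + e x * B - ∑ y ∈ T, K y x * m y * u y)
    (hw : ∀ x ∈ T, w x = e x - ∑ y ∈ T, K x y * m y * w y) :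
    ∑ y ∈ T, e y * m y * u y =
      A * ∑ y ∈ T, e' y * m y * w y + B * ∑ y ∈ T, e y * m y * w y := by
  have h1 : ∑ y ∈ T, m y * u y * w y = ∑ y ∈ T, e y * m y * u y -
      ∑ y ∈ T, ∑ x ∈ T, m y * u y * (K y x * m x * w x) := by
    rw [← Finset.sum_sub_distrib]
    refine Finset.sum_congr rfl fun y hy => ?_
    rw [hw y hy, mul_sub, Finset.mul_sum]; ring
  have h2 : ∑ y ∈ T, m y * u y * w y =
      (A * ∑ y ∈ T, e' y * m y * w y + B * ∑ y ∈ T, e y * m y * w y) -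
      ∑ x ∈ T, ∑ y ∈ T, m y * u y * (K y x * m x * w x) := by
    rw [Finset.mul_sum, Finset.mul_sum, ← Finset.sum_add_distrib, ← Finset.sum_sub_distrib]
    refine Finset.sum_congr rfl fun x hx => ?_
    rw [hu x hx, mul_sub, sub_mul, Finset.mul_sum, Finset.sum_mul]
    congr 1
    · ring
    · exact Finset.sum_congr rfl fun y _ => by ring
  rw [Finset.sum_comm] at h2
  linear_combination h2 - h1

theorem sum_filter_lt_add_sum_filter_le {M : Type*} [AddCommMonoid M] (S : Finset ℝ) (a : ℝ)
    (F : ℝ → M) : ∑ y ∈ S, F y = ∑ y ∈ S with a < y, F y + ∑ y ∈ S with y ≤ a, F y := by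
  rw [← Finset.sum_filter_add_sum_filter_not S (a < ·)]
  simp only [not_lt]

theorem sum_filter_points_le (p : MeasurePair) (a : ℝ) (F G : ℝ → ℝ[X]) :
    ∑ y ∈ p.points with y ≤ a, F y * (X * density p y) * G y =
      ∑ y ∈ p.points with y < a, F y * (X * density p y) * G y +
        F a * (X * density p a) * G a := by
  by_cases ha : a ∈ p.points
  · have : p.points.filter (· ≤ a) = insert a (p.points.filter (· < a)) := by
      ext y
      simp only [Finset.mem_filter, Finset.mem_insert, le_iff_eq_or_lt]
      constructor
      · rintro ⟨h1, h2 | h2⟩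
        · exact Or.inl h2
        · exact Or.inr ⟨h1, h2⟩
      · rintro (rfl | ⟨h1, h2⟩)
        · exact ⟨ha, Or.inl rfl⟩
        · exact ⟨h1, Or.inr h2⟩
    rw [this, Finset.sum_insert (by simp), add_comm]
  · have : p.points.filter (· ≤ a) = p.points.filter (· < a) := by
      refine Finset.filter_congr fun y hy => ⟨fun h => lt_of_le_of_ne h ?_, le_of_lt⟩
      rintro rfl; exact ha hy
    rw [this]
    simp [density_eq_zero_iff.2 ha]

theorem phi_eq_of_le (p : MeasurePair) {a x : ℝ} (hx : x ≤ a) :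
    phi p x = C (Real.exp (-x / 2)) *
        (1 - ∑ y ∈ p.points with a < y, C (Real.exp (y / 2)) * (X * density p y) * phi p y) +
      C (Real.exp (x / 2)) *
        (∑ y ∈ p.points with a < y, C (Real.exp (-y / 2)) * (X * density p y) * phi p y) -
      ∑ y ∈ p.points with y ≤ a, C (causalKernel (y - x)) * (X * density p y) * phi p y := by
  conv_lhs => rw [phi_eq, sum_filter_lt_add_sum_filter_le _ a]
  rw [mul_sub, Finset.mul_sum, Finset.mul_sum, mul_one, sub_add, ← Finset.sum_sub_distrib,
    ← sub_sub]
  congr 2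
  refine Finset.sum_congr rfl fun y hy => ?_
  have hy := (Finset.mem_filter.1 hy).2
  rw [causalKernel_of_nonneg (by linarith), show (y - x) / 2 = -x / 2 + y / 2 by ring,
    show -(y - x) / 2 = x / 2 + -y / 2 by ring, Real.exp_add, Real.exp_add, C_sub, C_mul, C_mul]
  ring

theorem phiMinus_eq_of_le (p : MeasurePair) {a x : ℝ} (hx : x ≤ a) :
    phiMinus p x = C (Real.exp (x / 2)) -
      ∑ y ∈ p.points with y ≤ a, C (causalKernel (x - y)) * (X * density p y) * phiMinus p y := by
  rw [phiMinus_eq, sum_filter_lt_add_sum_filter_le _ a, Finset.sum_eq_zero, zero_add]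
  intro y hy
  have hy := (Finset.mem_filter.1 hy).2
  rw [causalKernel_of_nonpos (by linarith)]; simp

theorem C_exp_half_mul (a : ℝ) : C (Real.exp (a / 2)) * C (Real.exp (-a / 2)) = (1 : ℝ[X]) := by
  rw [← C_mul, ← Real.exp_add, show a / 2 + -a / 2 = 0 by ring, Real.exp_zero, C_1]

theorem halfValue_eq_of_sums (p : MeasurePair) (a : ℝ) : halfValue p a =
    1 - ∑ y ∈ p.points with a < y, C (Real.exp (y / 2)) * (X * density p y) * phi p y +
      X * halfSlope p a := by
  have e2 : C (Real.exp a) = C (Real.exp (a / 2)) * (C (Real.exp (a / 2)) : ℝ[X]) := by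
    rw [← C_mul, ← Real.exp_add]; congr 2; ring
  have h0 : ∑ y ∈ p.points with y ≤ a,
      C (causalKernel (y - a)) * (X * density p y) * phi p y = 0 := by
    refine Finset.sum_eq_zero fun y hy => ?_
    have hy := (Finset.mem_filter.1 hy).2
    rw [causalKernel_of_nonpos (by linarith)]; simp
  rw [X_mul_halfSlope, halfValue, phi_eq_of_le p le_rfl, h0, sub_zero, e2]
  linear_combination (1 - ∑ y ∈ p.points with a < y,
      C (Real.exp (y / 2)) * (X * density p y) * phi p y) * C_exp_half_mul a

theorem halfValue_reflect_eq_of_sums (p : MeasurePair) (a : ℝ) : halfValue p.reflect (-a) =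
    1 - ∑ y ∈ p.points with y < a, C (Real.exp (-y / 2)) * (X * density p y) * phiMinus p y +
      X * halfSlope p.reflect (-a) := by
  rw [halfValue_eq_of_sums, Finset.sum_filter, sum_points_reflect, Finset.sum_filter]
  simp only [neg_lt_neg_iff, density_reflect, neg_neg, phiMinus]

/-- The part of the Wronskian sum over `y ≤ a` is rewritten in terms of `φ₋`: there `φ₊` solves an
equation causal from the right, with coefficients fixed by the masses beyond `a`, and `φ₋` solves
the transposed one. -/
theorem wronskian_eq (p : MeasurePair) (a : ℝ) :
    wronskian p = halfValue p a * halfValue p.reflect (-a) * (1 - X * density p a) -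
      X * (halfSlope p a * halfValue p.reflect (-a) +
        halfSlope p.reflect (-a) * halfValue p a) := by
  have hkey := sum_mul_eq_of_volterra (p.points.filter (· ≤ a)) (fun y => X * density p y) (phi p)
    (phiMinus p) (fun y => C (Real.exp (y / 2))) (fun y => C (Real.exp (-y / 2)))
    (fun x y => C (causalKernel (x - y))) _ _
    (fun x hx => phi_eq_of_le p (Finset.mem_filter.1 hx).2)
    (fun x hx => phiMinus_eq_of_le p (Finset.mem_filter.1 hx).2)
  rw [sum_filter_points_le p a (fun y => C (Real.exp (-y / 2))) (phiMinus p),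
    sum_filter_points_le p a (fun y => C (Real.exp (y / 2))) (phiMinus p)] at hkey
  have hW := sum_filter_lt_add_sum_filter_le p.points a
    (fun y => C (Real.exp (y / 2)) * (X * density p y) * phi p y)
  have hW' : wronskian p = 1 - ∑ y ∈ p.points, C (Real.exp (y / 2)) * (X * density p y) * phi p y :=
    rfl
  have e1 := C_exp_half_mul a
  have e2 : C (Real.exp a) = C (Real.exp (a / 2)) * (C (Real.exp (a / 2)) : ℝ[X]) := by
    rw [← C_mul, ← Real.exp_add]; congr 2; ring
  have e3 : C (Real.exp (-a)) = C (Real.exp (-a / 2)) * (C (Real.exp (-a / 2)) : ℝ[X]) := by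
    rw [← C_mul, ← Real.exp_add]; congr 2; ring
  have hma : phiMinus p a = C (Real.exp (a / 2)) * halfValue p.reflect (-a) := by
    rw [halfValue_reflect]; linear_combination -phiMinus p a * e1
  have hdp := X_mul_halfSlope p a
  have hdm := X_mul_halfSlope_reflect p a
  have hgp := halfValue_eq_of_sums p a
  have hgm := halfValue_reflect_eq_of_sums p a
  rw [e2] at hdp
  rw [e3] at hdm
  rw [hma] at hkey
  rw [hdp] at hgp
  rw [hdm] at hgm
  rw [hW']
  -- From here the claim is an identity in a commutative ring, so all sums become variables.
  generalize ∑ y ∈ p.points with a < y, C (Real.exp (y / 2)) * (X * density p y) * phi p y = P at *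
  generalize ∑ y ∈ p.points with a < y, C (Real.exp (-y / 2)) * (X * density p y) * phi p y = Q at *
  generalize ∑ y ∈ p.points with y < a,
    C (Real.exp (-y / 2)) * (X * density p y) * phiMinus p y = P' at *
  generalize ∑ y ∈ p.points with y < a,
    C (Real.exp (y / 2)) * (X * density p y) * phiMinus p y = Q' at *
  generalize ∑ y ∈ p.points with y ≤ a, C (Real.exp (y / 2)) * (X * density p y) * phi p y = T at *
  generalize ∑ y ∈ p.points, C (Real.exp (y / 2)) * (X * density p y) * phi p y = T' at *
  generalize C (Real.exp (a / 2)) = s at *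
  generalize C (Real.exp (-a / 2)) = s' at *
  generalize halfValue p a = gp at *
  generalize halfValue p.reflect (-a) = gm at *
  generalize halfSlope p a = dp at *
  generalize halfSlope p.reflect (-a) = dm at *
  generalize density p a = r at *
  clear hW' hma e2 e3
  linear_combination -hW - hkey + (X * r * gm - gm + s' * s' * Q') * hgp - (1 - P) * hgm +
    gm * hdp + gp * hdm + (Q * Q' * (s * s' + 1) - X * r * gm * (1 - P)) * e1

theorem halfValue_eval_zero (p : MeasurePair) (b : ℝ) : (halfValue p b).eval 0 = 1 := by
  rw [halfValue_eq, eval_sub, eval_finsetSum]; simp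

theorem wronskian_eval_zero (p : MeasurePair) : (wronskian p).eval 0 = 1 := by
  rw [wronskian, eval_sub, eval_finsetSum]; simp

/-! ### The direct problem and uniqueness on a half-line: Herglotz pairs -/

/-- `d / g` is a Herglotz–Nevanlinna function that vanishes at infinity, in terms of the zeros of
the denominator, and `g(0) = 1`. -/
structure IsHerglotzPair (g d : ℝ[X]) : Prop where
  eval_zero : g.eval 0 = 1
  degree_lt : d.degree < g.degree
  im_eq_zero : ∀ z : ℂ, aeval z g = 0 → z.im = 0
  sign : ∀ x : ℝ, g.eval x = 0 → d.eval x * (derivative g).eval x < 0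

/-- `d / g` is a Herglotz–Nevanlinna function that vanishes at infinity, in terms of the
nonnegativity of its Bezoutian. -/
structure IsBezoutNonneg (g d : ℝ[X]) : Prop where
  coprime : IsCoprime g d
  degree_lt : d.degree < g.degree
  im_nonneg : ∀ z : ℂ, 0 < z.im → 0 ≤ (aeval z d * (starRingEnd ℂ) (aeval z g)).im
  wronskian_nonneg : ∀ x : ℝ,
    0 ≤ (derivative d).eval x * g.eval x - d.eval x * (derivative g).eval x

theorem IsBezoutNonneg.one_zero : IsBezoutNonneg 1 0 where
  coprime := isCoprime_one_left
  degree_lt := by simp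
  im_nonneg := by simp
  wronskian_nonneg := by simp

section Step

variable {g d g₁ d₁ : ℝ[X]} {ω v c l : ℝ}

theorem degree_add_linear_mul (hd : d.degree < g.degree) (hne : C ω + C v * X ≠ 0) :
    g.degree ≤ (d + (C ω + C v * X) * g).degree := by
  have h1 : g.degree ≤ ((C ω + C v * X) * g).degree := by
    rw [degree_mul]
    exact le_add_of_nonneg_left (zero_le_degree_iff.2 hne)
  rwa [degree_add_eq_right_of_degree_lt (hd.trans_le h1)]

/-- The mass term `ρ g` dominates `d`, and then `l X d₁` dominates `g`. Hence the ratio of the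
leading coefficients of `g₁` and `d₁` is `-l` and remembers the gap to the next point. -/
theorem degree_step (hd : d.degree < g.degree) (hc : 0 < c) (hl : 0 < l)
    (hne : C ω + C v * X ≠ 0) (hd₁ : d₁ = C c * (d + (C ω + C v * X) * g))
    (hg₁ : g₁ = g - C l * X * d₁) :
    d₁ ≠ 0 ∧ g.degree ≤ d₁.degree ∧ g₁.natDegree = d₁.natDegree + 1 ∧
      g₁.leadingCoeff = -l * d₁.leadingCoeff := by
  have h1 : g.degree ≤ d₁.degree := by
    rw [hd₁, degree_C_mul hc.ne']
    exact degree_add_linear_mul hd hne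
  have h0 : d₁ ≠ 0 := by
    rintro rfl
    rw [degree_zero, le_bot_iff] at h1
    rw [h1] at hd
    exact not_lt_bot hd
  have hlX : C l * X * d₁ ≠ 0 := mul_ne_zero (mul_ne_zero (C_ne_zero.2 hl.ne') X_ne_zero) h0
  have h2 : (C l * X * d₁).natDegree = d₁.natDegree + 1 := by
    rw [mul_assoc, natDegree_C_mul hl.ne', natDegree_X_mul h0]
  have h3 : g.degree < (C l * X * d₁).degree := by
    refine h1.trans_lt ?_
    rw [degree_eq_natDegree h0, degree_eq_natDegree hlX, h2]
    exact_mod_cast Nat.lt_succ_self _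
  refine ⟨h0, h1, ?_, ?_⟩
  · rw [hg₁, natDegree_sub_eq_right_of_natDegree_lt, h2]
    exact natDegree_lt_natDegree (fun h => by
      rw [h, degree_zero] at hd; exact not_lt_bot hd) h3
  · rw [hg₁, leadingCoeff_sub_of_degree_lt' h3]
    simp

/-- Adding the mass preserves both nonnegativity conditions because `v ≥ 0`; adding the gap
increases them by `l |d₁|²` (times `Im z` off the line). By coprimality `d₁` does not vanish at a
zero of `g₁`, so this gain rules out nonreal zeros and makes the sign at real zeros strict. -/
theorem IsBezoutNonneg.step (h : IsBezoutNonneg g d) (hc : 0 < c) (hl : 0 < l) (hv : 0 ≤ v)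
    (hne : C ω + C v * X ≠ 0) (hd₁ : d₁ = C c * (d + (C ω + C v * X) * g))
    (hg₁ : g₁ = g - C l * X * d₁) :
    IsBezoutNonneg g₁ d₁ ∧ (∀ z : ℂ, aeval z g₁ = 0 → z.im = 0) ∧
      ∀ x : ℝ, g₁.eval x = 0 → d₁.eval x * (derivative g₁).eval x < 0 := by
  obtain ⟨h0, h1, h2, -⟩ := degree_step h.degree_lt hc hl hne hd₁ hg₁
  have hcop : IsCoprime g₁ d₁ := by
    have e1 : IsCoprime g d₁ := by
      rw [hd₁, isCoprime_mul_unit_left_right (isUnit_C.2 hc.ne'.isUnit)]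
      exact h.coprime.add_mul_right_right _
    rw [hg₁, sub_eq_add_neg, ← neg_mul]
    exact e1.add_mul_right_left _
  have him : ∀ z : ℂ, 0 < z.im → l * z.im * Complex.normSq (aeval z d₁) ≤
      (aeval z d₁ * (starRingEnd ℂ) (aeval z g₁)).im := by
    intro z hz
    have e1 : 0 ≤ (aeval z d₁ * (starRingEnd ℂ) (aeval z g)).im := by
      have : (aeval z d₁ * (starRingEnd ℂ) (aeval z g)).im =
          c * ((aeval z d * (starRingEnd ℂ) (aeval z g)).im +
            v * z.im * Complex.normSq (aeval z g)) := by
        rw [hd₁]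
        simp [Complex.normSq_apply]
        ring
      rw [this]
      have := h.im_nonneg z hz
      have := Complex.normSq_nonneg (aeval z g)
      positivity
    have e2 : (aeval z d₁ * (starRingEnd ℂ) (aeval z g₁)).im =
        (aeval z d₁ * (starRingEnd ℂ) (aeval z g)).im +
          l * z.im * Complex.normSq (aeval z d₁) := by
      rw [hg₁]
      simp [Complex.normSq_apply]
      ring
    linarith
  have hre : ∀ x : ℝ, l * d₁.eval x ^ 2 ≤
      (derivative d₁).eval x * g₁.eval x - d₁.eval x * (derivative g₁).eval x := by
    intro x
    have e1 : 0 ≤ (derivative d₁).eval x * g.eval x - d₁.eval x * (derivative g).eval x := by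
      have : (derivative d₁).eval x * g.eval x - d₁.eval x * (derivative g).eval x =
          c * (((derivative d).eval x * g.eval x - d.eval x * (derivative g).eval x) +
            v * g.eval x ^ 2) := by
        rw [hd₁]
        simp
        ring
      rw [this]
      have := h.wronskian_nonneg x
      positivity
    have e2 : (derivative d₁).eval x * g₁.eval x - d₁.eval x * (derivative g₁).eval x =
        ((derivative d₁).eval x * g.eval x - d₁.eval x * (derivative g).eval x) +
          l * d₁.eval x ^ 2 := by
      rw [hg₁]
      simp
      ring
    linarith
  obtain ⟨u, w, huw⟩ := hcop
  have hroot : ∀ z : ℂ, 0 < z.im → aeval z g₁ ≠ 0 := by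
    intro z hz hz0
    have e1 := him z hz
    rw [hz0, map_zero, mul_zero, Complex.zero_im] at e1
    have e2 : Complex.normSq (aeval z d₁) ≤ 0 := by
      by_contra hcon
      have := mul_pos (mul_pos hl hz) (not_le.1 hcon)
      linarith
    have e3 : aeval z d₁ = 0 := Complex.normSq_eq_zero.1 (le_antisymm e2 (Complex.normSq_nonneg _))
    have := congrArg (aeval z) huw
    simp [hz0, e3] at this
  refine ⟨⟨⟨u, w, huw⟩, ?_, ?_, ?_⟩, ?_, ?_⟩
  · have hg0 : g₁ ≠ 0 := by rintro rfl; simp at h2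
    rw [degree_eq_natDegree h0, degree_eq_natDegree hg0, h2]
    exact_mod_cast Nat.lt_succ_self _
  · intro z hz
    have := him z hz
    have := Complex.normSq_nonneg (aeval z d₁)
    exact le_trans (by positivity) (him z hz)
  · intro x
    exact le_trans (by positivity) (hre x)
  · intro z hz
    by_contra hne'
    rcases lt_or_gt_of_ne hne' with h3 | h3
    · refine hroot ((starRingEnd ℂ) z) (by simpa using h3) ?_
      rw [aeval_conj, hz, map_zero]
    · exact hroot z h3 hz
  · intro x hx
    have e1 := hre x
    rw [hx, mul_zero] at e1
    have e2 : d₁.eval x ≠ 0 := by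
      intro e3
      have := congrArg (eval x) huw
      simp [hx, e3] at this
    have : 0 < l * d₁.eval x ^ 2 := by positivity
    linarith

end Step

theorem half_step {p : MeasurePair} {b : ℝ} (h : ¬ ∀ y, b < y → y ∉ p.points) :
    ∃ t, b < t ∧ density p t ≠ 0 ∧ (∀ y, b < y → y < t → density p y = 0) ∧
      (p.points.filter (t < ·)).card < (p.points.filter (b < ·)).card ∧
      halfSlope p b = C (Real.exp (b - t)) * (halfSlope p t + density p t * halfValue p t) ∧
      halfValue p b = halfValue p t - C (Real.exp (t - b) - 1) * X * halfSlope p b := by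
  obtain ⟨t, ht, hbt, hmin⟩ := exists_first_point h
  refine ⟨t, hbt, fun h0 => density_eq_zero_iff.1 h0 ht,
    fun y h1 h2 => density_eq_zero_iff.2 (hmin y h1 h2), ?_, halfSlope_step hbt hmin ht,
    halfValue_step hbt hmin ht⟩
  rw [filter_points_eq_insert hbt hmin ht, Finset.card_insert_of_notMem (by simp)]
  exact Nat.lt_succ_self _

theorem exp_sub_one_pos {b t : ℝ} (h : b < t) : 0 < Real.exp (t - b) - 1 := by
  have := Real.add_one_le_exp (t - b)
  linarith

theorem isBezoutNonneg_half (p : MeasurePair) (b : ℝ) :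
    IsBezoutNonneg (halfValue p b) (halfSlope p b) := by
  induction hn : (p.points.filter (b < ·)).card using Nat.strong_induction_on generalizing b with
  | _ n ih =>
    by_cases h : ∀ y, b < y → y ∉ p.points
    · rw [(half_of_forall_notMem h).1, (half_of_forall_notMem h).2]
      exact .one_zero
    · obtain ⟨t, hbt, hne, -, hcard, hd, hg⟩ := half_step h
      exact ((ih _ (hn ▸ hcard) t rfl).step (Real.exp_pos _) (exp_sub_one_pos hbt)
        (p.2 t).coe_nonneg hne hd hg).1

theorem isHerglotzPair_half (p : MeasurePair) (b : ℝ) :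
    IsHerglotzPair (halfValue p b) (halfSlope p b) := by
  by_cases h : ∀ y, b < y → y ∉ p.points
  · rw [(half_of_forall_notMem h).1, (half_of_forall_notMem h).2]
    exact ⟨by simp, by simp, by simp, by simp⟩
  · obtain ⟨t, hbt, hne, -, -, hd, hg⟩ := half_step h
    have := ((isBezoutNonneg_half p t).step (Real.exp_pos _) (exp_sub_one_pos hbt)
        (p.2 t).coe_nonneg hne hd hg).2
    exact ⟨halfValue_eval_zero p b, (isBezoutNonneg_half p b).degree_lt, this.1, this.2⟩

/-- With a mass to the right of `b`, the leading coefficient of `g` is `-l` times that of `d`, so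
the product is `-l` times a square. -/
theorem coeff_X_mul_halfSlope_mul_leadingCoeff_nonpos (p : MeasurePair) (b : ℝ) :
    (X * halfSlope p b).coeff (halfValue p b).natDegree * (halfValue p b).leadingCoeff ≤ 0 := by
  by_cases h : ∀ y, b < y → y ∉ p.points
  · rw [(half_of_forall_notMem h).1, (half_of_forall_notMem h).2]
    simp
  · obtain ⟨t, hbt, hne, -, -, hd, hg⟩ := half_step h
    obtain ⟨-, -, h1, h2⟩ := degree_step (isBezoutNonneg_half p t).degree_lt (Real.exp_pos _)
      (exp_sub_one_pos hbt) hne hd hg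
    rw [h1, h2, coeff_X_mul, coeff_natDegree]
    have := exp_sub_one_pos hbt
    nlinarith [mul_nonneg this.le (sq_nonneg (halfSlope p b).leadingCoeff)]

/-- The continued fraction can be read off from `(g, d)`: the leading coefficients give the gap, the
mass polynomial is a quotient with remainder, and the remaining pair belongs to fewer points. -/
theorem density_eq_of_half_eq {p q : MeasurePair} {b : ℝ} (hg : halfValue p b = halfValue q b)
    (hd : halfSlope p b = halfSlope q b) : ∀ y, b < y → density p y = density q y := by
  induction hn : (p.points.filter (b < ·)).card using Nat.strong_induction_on generalizing b with
  | _ n ih =>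
    by_cases hp : ∀ y, b < y → y ∉ p.points
    · by_cases hq : ∀ y, b < y → y ∉ q.points
      · intro y hy
        rw [density_eq_zero_iff.2 (hp y hy), density_eq_zero_iff.2 (hq y hy)]
      · exfalso
        obtain ⟨t, hbt, hne, -, -, hd', hg'⟩ := half_step hq
        obtain ⟨h0, -⟩ := degree_step (isBezoutNonneg_half q t).degree_lt (Real.exp_pos _)
          (exp_sub_one_pos hbt) hne hd' hg'
        exact h0 (hd ▸ (half_of_forall_notMem hp).2)
    · obtain ⟨t, hbt, hne, hz, hcard, hd', hg'⟩ := half_step hp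
      obtain ⟨h0, h1, h2, h3⟩ := degree_step (isBezoutNonneg_half p t).degree_lt (Real.exp_pos _)
        (exp_sub_one_pos hbt) hne hd' hg'
      by_cases hq : ∀ y, b < y → y ∉ q.points
      · exact absurd (hd.trans (half_of_forall_notMem hq).2) h0
      obtain ⟨s, hbs, hne', hz', -, hd'', hg''⟩ := half_step hq
      obtain ⟨-, -, -, h3'⟩ := degree_step (isBezoutNonneg_half q s).degree_lt (Real.exp_pos _)
        (exp_sub_one_pos hbs) hne' hd'' hg''
      have hst : s = t := by
        rw [← hg, ← hd, h3] at h3'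
        have := mul_right_cancel₀ (leadingCoeff_ne_zero.2 h0) h3'
        have : Real.exp (t - b) = Real.exp (s - b) := by linarith
        linarith [Real.exp_injective this]
      subst hst
      have hgt : halfValue p s = halfValue q s := by
        rw [hg, hd] at hg'
        rw [hg''] at hg'
        exact (sub_left_inj.1 hg').symm
      have hsum : halfSlope p s + density p s * halfValue p s =
          halfSlope q s + density q s * halfValue q s := by
        rw [hd, hd''] at hd'
        exact (mul_left_cancel₀ (C_ne_zero.2 (Real.exp_pos _).ne') hd').symm
      have hg0 : halfValue p s ≠ 0 := by
        intro h
        have := halfValue_eval_zero p s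
        rw [h] at this; simp at this
      -- Distinct quotients would make a nonzero multiple of `g` equal to a difference of
      -- remainders, which has smaller degree.
      have hdens : density p s = density q s := by
        by_contra hcon
        have e1 : (density p s - density q s) * halfValue p s = halfSlope q s - halfSlope p s := by
          rw [sub_mul]; nth_rewrite 2 [hgt]; linear_combination hsum
        have e2 : (halfSlope q s - halfSlope p s).degree < (halfValue p s).degree := by
          refine (degree_sub_le _ _).trans_lt (max_lt ?_ (isBezoutNonneg_half p s).degree_lt)
          rw [hgt]; exact (isBezoutNonneg_half q s).degree_lt
        rw [← e1, degree_mul] at e2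
        exact absurd e2 (not_lt.2 (le_add_of_nonneg_left
          (zero_le_degree_iff.2 (sub_ne_zero.2 hcon))))
      have hslope : halfSlope p s = halfSlope q s := by
        rw [hdens, hgt] at hsum
        exact add_right_cancel hsum
      intro y hy
      rcases lt_trichotomy y s with h | rfl | h
      · rw [hz y hy h, hz' y hy h]
      · exact hdens
      · exact ih _ (hn ▸ hcard) hgt hslope rfl y h

/-! ### The inverse problem on a half-line -/

theorem splits_of_forall_im_eq_zero {g : ℝ[X]} (h : ∀ z : ℂ, aeval z g = 0 → z.im = 0) :
    g.Splits := by
  refine Splits.of_splits_map (algebraMap ℝ ℂ) (IsAlgClosed.splits _) fun z hz => ?_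
  have := h z (by rw [aeval_def, eval₂_eq_eval_map]; exact isRoot_of_mem_roots hz)
  exact ⟨z.re, Complex.ext (by simp) (by simp [this])⟩

theorem nodup_roots_of_derivative_ne_zero {g : ℝ[X]}
    (h : ∀ x, g.eval x = 0 → (derivative g).eval x ≠ 0) : g.roots.Nodup := by
  rcases eq_or_ne g 0 with rfl | hg
  · simp
  rw [Multiset.nodup_iff_count_le_one]
  intro x
  rw [count_roots, ← not_lt, one_lt_rootMultiplicity_iff_isRoot hg]
  exact fun hx => h x hx.1 hx.2

namespace IsHerglotzPair

variable {g d : ℝ[X]}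

theorem ne_zero (h : IsHerglotzPair g d) : g ≠ 0 := by
  rintro rfl; simpa using h.eval_zero

theorem splits (h : IsHerglotzPair g d) : g.Splits := splits_of_forall_im_eq_zero h.im_eq_zero

theorem nodup_roots (h : IsHerglotzPair g d) : g.roots.Nodup :=
  nodup_roots_of_derivative_ne_zero fun x hx h0 => by
    have := h.sign x hx; rw [h0, mul_zero] at this; exact lt_irrefl _ this

theorem card_roots (h : IsHerglotzPair g d) : g.roots.toFinset.card = g.natDegree := by
  rw [Multiset.toFinset_card_of_nodup h.nodup_roots, ← h.splits.natDegree_eq_card_roots]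

theorem mem_roots_iff (h : IsHerglotzPair g d) {x : ℝ} : x ∈ g.roots.toFinset ↔ g.eval x = 0 := by
  rw [Multiset.mem_toFinset, mem_roots h.ne_zero, IsRoot.def]

/-- Partial fractions: `d / g = ∑ r σ / (σ - X)` with `r σ > 0`. -/
theorem exists_partialFractions (h : IsHerglotzPair g d) :
    ∃ (G : ℝ → ℝ[X]) (r : ℝ → ℝ), (∀ σ ∈ g.roots.toFinset, (C σ - X) * G σ = g ∧ 0 < r σ) ∧
      d = ∑ σ ∈ g.roots.toFinset, C (r σ) * G σ := by
  have hG : ∀ σ, ∃ G : ℝ[X], σ ∈ g.roots.toFinset → (C σ - X) * G = g := by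
    intro σ
    by_cases hσ : σ ∈ g.roots.toFinset
    · obtain ⟨G, hG⟩ := dvd_iff_isRoot.2 (h.mem_roots_iff.1 hσ)
      exact ⟨-G, fun _ => by rw [hG]; ring⟩
    · exact ⟨0, fun h => absurd h hσ⟩
  choose G hG using hG
  have hGeval : ∀ σ ∈ g.roots.toFinset, (G σ).eval σ = -(derivative g).eval σ := by
    intro σ hσ
    rw [← hG σ hσ]; simp
  have hdeg : ∀ σ ∈ g.roots.toFinset, (G σ).degree < g.degree := by
    intro σ hσ
    have h1 : (C σ - X : ℝ[X]).degree = 1 := by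
      rw [← neg_sub, degree_neg, degree_X_sub_C]
    have h2 : G σ ≠ 0 := fun h0 => h.ne_zero (by rw [← hG σ hσ, h0, mul_zero])
    rw [← hG σ hσ, degree_mul, h1, degree_eq_natDegree h2]
    exact_mod_cast (by omega : (G σ).natDegree < 1 + (G σ).natDegree)
  -- With `G σ = g / (σ - X)` one has `G σ (σ) = -g'(σ)`, which dictates the residue; its positivity
  -- is the sign condition of the pair.
  refine ⟨G, fun σ => -d.eval σ / (derivative g).eval σ, fun σ hσ => ⟨hG σ hσ, ?_⟩, ?_⟩
  · have h1 := h.sign σ (h.mem_roots_iff.1 hσ)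
    have h2 : (derivative g).eval σ ≠ 0 := by
      intro h0; rw [h0, mul_zero] at h1; exact lt_irrefl _ h1
    have h3 : -d.eval σ / (derivative g).eval σ =
        -(d.eval σ * (derivative g).eval σ) / ((derivative g).eval σ) ^ 2 := by
      field_simp
    simp only [h3]
    exact div_pos (by linarith) (by positivity)
  · have hcard : (g.roots.toFinset.card : WithBot ℕ) = g.degree := by
      rw [h.card_roots, degree_eq_natDegree h.ne_zero]
    refine eq_of_degrees_lt_of_eval_finset_eq g.roots.toFinset (hcard ▸ h.degree_lt) ?_ ?_
    · rw [hcard]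
      refine (degree_sum_le _ _).trans_lt ((Finset.sup_lt_iff ?_).2 fun σ hσ => ?_)
      · exact bot_lt_iff_ne_bot.2 (degree_ne_bot.2 h.ne_zero)
      · rw [← smul_eq_C_mul]; exact (degree_smul_le _ _).trans_lt (hdeg σ hσ)
    · intro x hx
      rw [eval_finsetSum, Finset.sum_eq_single_of_mem x hx]
      · have h1 := h.sign x (h.mem_roots_iff.1 hx)
        have h2 : (derivative g).eval x ≠ 0 := by
          intro h0; rw [h0, mul_zero] at h1; exact lt_irrefl _ h1
        rw [eval_mul, eval_C, hGeval x hx]; field_simp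
      · intro σ hσ hne
        have h1 := congrArg (eval x) (hG σ hσ)
        rw [eval_mul, h.mem_roots_iff.1 hx] at h1
        have h2 : (G σ).eval x = 0 := by
          refine (mul_eq_zero.1 h1).resolve_left ?_
          simpa [sub_eq_zero] using hne
        rw [eval_mul, h2, mul_zero]

/-- One step of the continued fraction is undone. The length `l` is chosen to cancel the top
coefficient of `g + l X d`, and division of `(1 + l) d` by this new denominator gives the mass as
quotient and the new numerator as remainder. Partial fractions show that the new pair is Herglotz
again. -/
theorem exists_step (h : IsHerglotzPair g d) (hn : g.natDegree ≠ 0) :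
    ∃ l > 0, ∃ ω v : ℝ, 0 ≤ v ∧ C ω + C v * X ≠ 0 ∧ ∃ g₁ d₁ : ℝ[X], IsHerglotzPair g₁ d₁ ∧
      g₁.natDegree < g.natDegree ∧ C (1 + l) * d = d₁ + (C ω + C v * X) * g₁ ∧
      g = g₁ - C l * X * d := by
  obtain ⟨G, r, hGr, hd⟩ := h.exists_partialFractions
  set T := g.roots.toFinset with hT
  have hTne : T.Nonempty := by rw [← Finset.card_pos, h.card_roots]; omega
  have hσ0 : ∀ σ ∈ T, σ ≠ 0 := by
    rintro σ hσ rfl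
    have := h.mem_roots_iff.1 hσ
    rw [h.eval_zero] at this; exact one_ne_zero this
  -- Since `d / g = ∑ r σ / (σ - X)`, the limit of `-z d / g` at infinity is `s`, so `l = 1 / s`.
  set s := ∑ σ ∈ T, r σ with hs
  have hspos : 0 < s := Finset.sum_pos (fun σ hσ => (hGr σ hσ).2) hTne
  set s₁ := ∑ σ ∈ T, r σ * σ with hs₁
  set s₂ := ∑ σ ∈ T, r σ * σ ^ 2 with hs₂
  have hs₂pos : 0 < s₂ := Finset.sum_pos (fun σ hσ => by
    have := (hGr σ hσ).2; have := hσ0 σ hσ; positivity) hTne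
  obtain ⟨g₁, hg₁⟩ : ∃ g₁, g₁ = g + C s⁻¹ * X * d := ⟨_, rfl⟩
  have hg₁' : g₁ = C s⁻¹ * ∑ σ ∈ T, C (r σ * σ) * G σ := by
    have e1 : g = C s⁻¹ * ∑ σ ∈ T, C (r σ) * ((C σ - X) * G σ) := by
      have : ∑ σ ∈ T, C (r σ) * ((C σ - X) * G σ) = C s * g := by
        rw [hs, map_sum, Finset.sum_mul]
        exact Finset.sum_congr rfl fun σ hσ => by rw [(hGr σ hσ).1]
      rw [this, ← mul_assoc, ← C_mul, inv_mul_cancel₀ hspos.ne', C_1, one_mul]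
    rw [hg₁, hd]
    conv_lhs => rw [e1]
    rw [mul_assoc, ← mul_add, Finset.mul_sum, ← Finset.sum_add_distrib]
    congr 1
    exact Finset.sum_congr rfl fun σ _ => by rw [C_mul]; ring
  have hg₁0 : g₁.eval 0 = 1 := by rw [hg₁]; simp [h.eval_zero]
  have hg₁ne : g₁ ≠ 0 := by intro h0; rw [h0] at hg₁0; simp at hg₁0
  set n := g.natDegree - 1 with hndef
  have hGdeg : ∀ σ ∈ T, (G σ).natDegree = n ∧ (G σ).coeff n = -g.leadingCoeff := by
    intro σ hσ
    have h2 : G σ ≠ 0 := fun h0 => h.ne_zero (by rw [← (hGr σ hσ).1, h0, mul_zero])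
    have h1 : (C σ - X : ℝ[X]) = -(X - C σ) := by ring
    have h3 := congrArg natDegree (hGr σ hσ).1
    have h4 := congrArg leadingCoeff (hGr σ hσ).1
    rw [h1, neg_mul, natDegree_neg, natDegree_mul (X_sub_C_ne_zero _) h2, natDegree_X_sub_C] at h3
    rw [h1, neg_mul, leadingCoeff_neg, leadingCoeff_mul, leadingCoeff_X_sub_C, one_mul] at h4
    have h5 : (G σ).natDegree = n := by omega
    exact ⟨h5, by rw [← h5, coeff_natDegree, ← h4, neg_neg]⟩
  have hcomb : ∀ w : ℝ → ℝ, (∑ σ ∈ T, C (w σ) * G σ).natDegree ≤ n ∧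
      (∑ σ ∈ T, C (w σ) * G σ).coeff n = (∑ σ ∈ T, w σ) * -g.leadingCoeff := by
    intro w
    constructor
    · refine natDegree_sum_le_of_forall_le _ _ fun σ hσ => ?_
      exact (natDegree_C_mul_le _ _).trans (hGdeg σ hσ).1.le
    · rw [finsetSum_coeff, Finset.sum_mul]
      exact Finset.sum_congr rfl fun σ hσ => by rw [coeff_C_mul, (hGdeg σ hσ).2]
  have hκ : -g.leadingCoeff ≠ 0 := neg_ne_zero.2 (leadingCoeff_ne_zero.2 h.ne_zero)
  have hdn : d.natDegree = n ∧ d.leadingCoeff = s * -g.leadingCoeff := by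
    obtain ⟨e1, e2⟩ := hcomb r
    rw [← hd] at e1 e2
    have e3 : d.natDegree = n :=
      natDegree_eq_of_le_of_coeff_ne_zero e1 (by rw [e2]; exact mul_ne_zero hspos.ne' hκ)
    exact ⟨e3, by rw [leadingCoeff, e3, e2]⟩
  have hd0 : d ≠ 0 := by
    intro h0
    have := hdn.2
    rw [h0, leadingCoeff_zero] at this
    exact mul_ne_zero hspos.ne' hκ this.symm
  have hg₁n : g₁.natDegree ≤ n := by
    rw [hg₁']
    exact (natDegree_C_mul_le _ _).trans (hcomb _).1
  -- The coefficient of `g₁` at degree `n` is proportional to `s₁`. If `s₁ = 0` the degree drops by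
  -- exactly one more, because `s₂ > 0`. Hence the quotient `e / g₁` has degree at most one.
  have hcases : g₁.natDegree = n ∨ (g₁.natDegree + 1 = n ∧
      g₁.leadingCoeff = s⁻¹ * (s₂ * -g.leadingCoeff)) := by
    by_cases hs₁0 : s₁ = 0
    · right
      have e1 : X * g₁ = C s⁻¹ * ∑ σ ∈ T, C (r σ * σ ^ 2) * G σ := by
        have : ∑ σ ∈ T, C (r σ * σ ^ 2) * G σ =
            X * ∑ σ ∈ T, C (r σ * σ) * G σ + ∑ σ ∈ T, C (r σ * σ) * ((C σ - X) * G σ) := by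
          rw [Finset.mul_sum, ← Finset.sum_add_distrib]
          refine Finset.sum_congr rfl fun σ _ => ?_
          simp only [C_mul, C_pow]; ring
        have e2 : ∑ σ ∈ T, C (r σ * σ) * ((C σ - X) * G σ) = 0 := by
          rw [Finset.sum_congr rfl fun σ hσ => by rw [(hGr σ hσ).1], ← Finset.sum_mul, ← map_sum,
            ← hs₁, hs₁0, C_0, zero_mul]
        rw [this, e2, add_zero, hg₁']; ring
      have e3 := congrArg (coeff · n) e1
      simp only [coeff_C_mul, (hcomb _).2] at e3
      have e4 : (X * g₁).natDegree = n := by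
        refine natDegree_eq_of_le_of_coeff_ne_zero ?_ ?_
        · rw [e1]
          exact (natDegree_C_mul_le _ _).trans (hcomb _).1
        · rw [e3]
          exact mul_ne_zero (inv_ne_zero hspos.ne') (mul_ne_zero hs₂pos.ne' hκ)
      rw [natDegree_X_mul hg₁ne] at e4
      refine ⟨e4, ?_⟩
      rw [← e3, ← e4, coeff_X_mul, coeff_natDegree]
    · left
      refine natDegree_eq_of_le_of_coeff_ne_zero hg₁n ?_
      rw [hg₁', coeff_C_mul, (hcomb _).2]
      exact mul_ne_zero (inv_ne_zero hspos.ne') (mul_ne_zero hs₁0 hκ)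
  have hl1 : (0 : ℝ) < 1 + s⁻¹ := by positivity
  set e := C (1 + s⁻¹) * d with he
  have hen : e.natDegree = n := by rw [he, natDegree_C_mul hl1.ne', hdn.1]
  have he0 : e ≠ 0 := mul_ne_zero (C_ne_zero.2 hl1.ne') hd0
  have hle : g₁.degree ≤ e.degree := by
    rw [degree_eq_natDegree hg₁ne, degree_eq_natDegree he0, hen]
    exact_mod_cast hg₁n
  have hρ0 : e / g₁ ≠ 0 := by
    rw [Ne, Polynomial.div_eq_zero_iff hg₁ne]
    exact not_lt.2 hle
  have hρn : g₁.natDegree + (e / g₁).natDegree = n := by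
    have := degree_add_div hg₁ne hle
    rw [degree_eq_natDegree hg₁ne, degree_eq_natDegree he0, degree_eq_natDegree hρ0, hen] at this
    exact_mod_cast this
  have hρ : e / g₁ = C ((e / g₁).coeff 0) + C ((e / g₁).coeff 1) * X := by
    rw [add_comm]
    exact eq_X_add_C_of_natDegree_le_one (by omega)
  -- The quotient is constant in the first case; in the second its slope is `(1 + s⁻¹) s² / s₂`.
  have hv : 0 ≤ (e / g₁).coeff 1 := by
    rcases hcases with hc | ⟨hc1, hc2⟩
    · rw [coeff_eq_zero_of_natDegree_lt (by omega)]
    · have e1 : (e / g₁).natDegree = 1 := by omega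
      have e2 := leadingCoeff_div hle
      rw [leadingCoeff, e1, he, leadingCoeff_mul, leadingCoeff_C, hdn.2, hc2] at e2
      rw [e2, ← mul_assoc, ← mul_assoc, mul_div_mul_right _ _ hκ]
      positivity
  refine ⟨s⁻¹, inv_pos.2 hspos, (e / g₁).coeff 0, (e / g₁).coeff 1, hv, hρ ▸ hρ0, g₁, e % g₁,
    ⟨hg₁0, EuclideanDomain.mod_lt _ hg₁ne, ?_, ?_⟩, by omega, ?_, by rw [hg₁]; ring⟩
  · intro z hz
    by_contra him
    have hgz : aeval z g ≠ 0 := fun h0 => him (h.im_eq_zero z h0)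
    have hσz : ∀ σ : ℝ, (σ : ℂ) - z ≠ 0 := by
      intro σ h0
      apply him
      rw [← sub_eq_zero.1 h0]; simp
    -- A nonreal zero of `g₁` would be a zero of `∑ r σ σ / (σ - z)`; its imaginary and real parts
    -- together force `∑ r σ σ² / |σ - z|² = 0`, a sum of positive terms.
    have e1 : ∑ σ ∈ T, ((r σ * σ : ℝ) : ℂ) * ((σ : ℂ) - z)⁻¹ = 0 := by
      have e2 : aeval z g₁ = ((s⁻¹ : ℝ) : ℂ) *
          ((∑ σ ∈ T, ((r σ * σ : ℝ) : ℂ) * ((σ : ℂ) - z)⁻¹) * aeval z g) := by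
        rw [hg₁', map_mul, map_sum, Finset.sum_mul, aeval_C]
        congr 1
        refine Finset.sum_congr rfl fun σ hσ => ?_
        conv_rhs => rw [← (hGr σ hσ).1]
        have := hσz σ
        simp only [map_mul, map_sub, aeval_C, aeval_X, Complex.coe_algebraMap, Complex.ofReal_mul]
        field_simp
      rw [hz] at e2
      refine (mul_eq_zero.1 ((mul_eq_zero.1 e2.symm).resolve_left ?_)).resolve_right hgz
      exact Complex.ofReal_ne_zero.2 (inv_ne_zero hspos.ne')
    set u : ℝ → ℝ := fun σ => (Complex.normSq ((σ : ℂ) - z))⁻¹ with hu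
    have hupos : ∀ σ, 0 < u σ := fun σ => inv_pos.2 (Complex.normSq_pos.2 (hσz σ))
    have e2 := congrArg Complex.im e1
    have e3 := congrArg Complex.re e1
    simp only [Complex.im_sum, Complex.re_sum, Complex.im_ofReal_mul, Complex.re_ofReal_mul,
      Complex.inv_im, Complex.inv_re, Complex.zero_im, Complex.zero_re, Complex.sub_im,
      Complex.sub_re, Complex.ofReal_im, Complex.ofReal_re, zero_sub, neg_neg] at e2 e3
    have e4 : ∑ σ ∈ T, r σ * σ * u σ = 0 := by
      have : (∑ σ ∈ T, r σ * σ * u σ) * z.im = 0 := by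
        rw [← e2, Finset.sum_mul]
        exact Finset.sum_congr rfl fun σ _ => by rw [hu]; ring
      exact (mul_eq_zero.1 this).resolve_right him
    have e5 : ∑ σ ∈ T, r σ * σ ^ 2 * u σ = 0 := by
      have : ∑ σ ∈ T, r σ * σ ^ 2 * u σ = ∑ σ ∈ T, r σ * σ *
          ((σ - z.re) / Complex.normSq ((σ : ℂ) - z)) + z.re * ∑ σ ∈ T, r σ * σ * u σ := by
        rw [Finset.mul_sum, ← Finset.sum_add_distrib]
        exact Finset.sum_congr rfl fun σ _ => by rw [hu]; ring
      rw [this, e3, e4]; ring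
    refine (Finset.sum_pos (fun σ hσ => ?_) hTne).ne' e5
    have := (hGr σ hσ).2; have := hσ0 σ hσ; have := hupos σ
    positivity
  · intro x hx
    have hx1 : (e % g₁).eval x = (1 + s⁻¹) * d.eval x := by
      have := congrArg (eval x) (EuclideanDomain.div_add_mod e g₁)
      rw [eval_add, eval_mul, hx, zero_mul, zero_add] at this
      rw [this, he, eval_mul, eval_C]
    rw [hx1, mul_assoc]
    refine mul_neg_of_pos_of_neg hl1 ?_
    have hgx : g.eval x ≠ 0 := by
      intro h0
      have e1 := congrArg (eval x) hg₁
      rw [hx] at e1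
      simp only [eval_add, eval_mul, eval_C, eval_X, h0, zero_add] at e1
      have e2 := h.sign x h0
      have e3 : d.eval x ≠ 0 := by intro e; rw [e, zero_mul] at e2; exact lt_irrefl _ e2
      have e4 : x ≠ 0 := hσ0 x (h.mem_roots_iff.2 h0)
      exact mul_ne_zero (mul_ne_zero (inv_ne_zero hspos.ne') e4) e3 e1.symm
    have hσx : ∀ σ ∈ T, σ - x ≠ 0 := by
      intro σ hσ h0
      exact hgx (sub_eq_zero.1 h0 ▸ h.mem_roots_iff.1 hσ)
    have hGx : ∀ σ ∈ T, (G σ).eval x = g.eval x * (σ - x)⁻¹ := by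
      intro σ hσ
      have := hσx σ hσ
      rw [← (hGr σ hσ).1]; simp; field_simp
    have hGx' : ∀ σ ∈ T, (derivative (G σ)).eval x =
        ((derivative g).eval x + g.eval x * (σ - x)⁻¹) * (σ - x)⁻¹ := by
      intro σ hσ
      have h1 := hσx σ hσ
      have h2 := congrArg (fun P => (derivative P).eval x) (hGr σ hσ).1
      simp only [derivative_mul, derivative_sub, derivative_C, derivative_X, eval_add, eval_mul,
        eval_sub, Polynomial.eval_zero, eval_one, eval_C, eval_X] at h2
      rw [← h2, hGx σ hσ]; field_simp; ring
    have e1 : ∑ σ ∈ T, r σ * σ * (σ - x)⁻¹ = 0 := by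
      have e2 : g₁.eval x = s⁻¹ * (g.eval x * ∑ σ ∈ T, r σ * σ * (σ - x)⁻¹) := by
        rw [hg₁', eval_mul, eval_C, eval_finsetSum, Finset.mul_sum (a := g.eval x)]
        congr 1
        refine Finset.sum_congr rfl fun σ hσ => ?_
        rw [eval_mul, eval_C, hGx σ hσ]; ring
      rw [hx] at e2
      exact (mul_eq_zero.1 ((mul_eq_zero.1 e2.symm).resolve_left
        (inv_ne_zero hspos.ne'))).resolve_left hgx
    have e2 : d.eval x = g.eval x * ∑ σ ∈ T, r σ * (σ - x)⁻¹ := by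
      rw [hd, eval_finsetSum, Finset.mul_sum]
      refine Finset.sum_congr rfl fun σ hσ => ?_
      rw [eval_mul, eval_C, hGx σ hσ]; ring
    have e3 : (derivative g₁).eval x = s⁻¹ * (g.eval x * ∑ σ ∈ T, r σ * σ * ((σ - x)⁻¹) ^ 2) := by
      have : (derivative g₁).eval x = s⁻¹ * ((derivative g).eval x *
          (∑ σ ∈ T, r σ * σ * (σ - x)⁻¹) + g.eval x * ∑ σ ∈ T, r σ * σ * ((σ - x)⁻¹) ^ 2) := by
        rw [hg₁', derivative_mul, derivative_C, zero_mul, zero_add, derivative_sum, eval_mul,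
          eval_C, eval_finsetSum, Finset.mul_sum (a := (derivative g).eval x),
          Finset.mul_sum (a := g.eval x), ← Finset.sum_add_distrib]
        congr 1
        refine Finset.sum_congr rfl fun σ hσ => ?_
        rw [derivative_C_mul, eval_mul, eval_C, hGx' σ hσ]; ring
      rw [this, e1]; ring
    have e4 : x * ∑ σ ∈ T, r σ * (σ - x)⁻¹ = -s := by
      have : x * ∑ σ ∈ T, r σ * (σ - x)⁻¹ + s = ∑ σ ∈ T, r σ * σ * (σ - x)⁻¹ := by
        rw [hs, Finset.mul_sum, ← Finset.sum_add_distrib]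
        refine Finset.sum_congr rfl fun σ hσ => ?_
        have := hσx σ hσ
        field_simp; ring
      linarith
    have e5 : x * ∑ σ ∈ T, r σ * σ * ((σ - x)⁻¹) ^ 2 =
        ∑ σ ∈ T, r σ * σ ^ 2 * ((σ - x)⁻¹) ^ 2 := by
      have : x * ∑ σ ∈ T, r σ * σ * ((σ - x)⁻¹) ^ 2 + ∑ σ ∈ T, r σ * σ * (σ - x)⁻¹ =
          ∑ σ ∈ T, r σ * σ ^ 2 * ((σ - x)⁻¹) ^ 2 := by
        rw [Finset.mul_sum, ← Finset.sum_add_distrib]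
        refine Finset.sum_congr rfl fun σ hσ => ?_
        have := hσx σ hσ
        field_simp; ring
      linarith
    have e6 : 0 < ∑ σ ∈ T, r σ * σ ^ 2 * ((σ - x)⁻¹) ^ 2 := by
      refine Finset.sum_pos (fun σ hσ => ?_) hTne
      have := (hGr σ hσ).2; have := hσ0 σ hσ; have := hσx σ hσ
      positivity
    have e7 : x ≠ 0 := by rintro rfl; rw [zero_mul] at e4; linarith
    -- At a zero `x` of `g₁`, both `d x` and `g₁'(x)` become explicit after multiplication by `x`,
    -- by `x / (σ - x) = σ / (σ - x) - 1`; the product is minus a sum of positive terms.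
    have e8 : x ^ 2 * (d.eval x * (derivative g₁).eval x) =
        -(g.eval x ^ 2 * ∑ σ ∈ T, r σ * σ ^ 2 * ((σ - x)⁻¹) ^ 2) := by
      rw [← e5, e2, e3]
      have : x ^ 2 * (g.eval x * (∑ σ ∈ T, r σ * (σ - x)⁻¹) *
          (s⁻¹ * (g.eval x * ∑ σ ∈ T, r σ * σ * (σ - x)⁻¹ ^ 2))) =
          (x * ∑ σ ∈ T, r σ * (σ - x)⁻¹) * s⁻¹ *
            (g.eval x ^ 2 * (x * ∑ σ ∈ T, r σ * σ * (σ - x)⁻¹ ^ 2)) := by ring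
      rw [this, e4]
      field_simp
    by_contra hcon
    have h9 : 0 ≤ x ^ 2 * (d.eval x * (derivative g₁).eval x) :=
      mul_nonneg (sq_nonneg _) (not_lt.1 hcon)
    rw [e8] at h9
    have : 0 < g.eval x ^ 2 * ∑ σ ∈ T, r σ * σ ^ 2 * ((σ - x)⁻¹) ^ 2 := by positivity
    linarith
  · rw [← hρ, add_comm (e % g₁), mul_comm (e / g₁)]
    exact (EuclideanDomain.div_add_mod e g₁).symm

end IsHerglotzPair

/-- Inverse problem on a half-line. -/
theorem IsHerglotzPair.exists_half {g d : ℝ[X]} (h : IsHerglotzPair g d) (b : ℝ) :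
    ∃ p : MeasurePair, halfValue p b = g ∧ halfSlope p b = d := by
  induction hn : g.natDegree using Nat.strong_induction_on generalizing g d b with
  | _ n ih =>
    by_cases hn0 : g.natDegree = 0
    · have hg := eq_C_of_natDegree_eq_zero hn0
      have h1 : g = 1 := by
        have := h.eval_zero
        rw [hg, eval_C] at this
        rw [hg, this, C_1]
      have h2 : d = 0 := by
        have := h.degree_lt
        rw [h1, degree_one, ← not_le, zero_le_degree_iff, not_not] at this
        exact this
      refine ⟨0, ?_⟩
      rw [h1, h2]
      exact half_of_forall_notMem fun y _ => by simp [MeasurePair.points]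
    · obtain ⟨l, hl, ω, v, hv, hne, g₁, d₁, h₁, hlt, hd, hg⟩ := h.exists_step hn0
      lift v to ℝ≥0 using hv
      have hl1 : (0 : ℝ) < 1 + l := by linarith
      -- The first mass sits at the point `t` with `e^{t-b} - 1 = l`.
      set t := b + Real.log (1 + l) with ht
      have hbt : b < t := by
        have := Real.log_pos (x := 1 + l) (by linarith)
        linarith
      have hexp : Real.exp (t - b) = 1 + l := by
        rw [ht, add_sub_cancel_left, Real.exp_log hl1]
      obtain ⟨q, hq1, hq2⟩ := ih _ (hn ▸ hlt) h₁ t rfl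
      let p : MeasurePair := ((q.1.filter (t < ·)).update t ω, (q.2.filter (t < ·)).update t v)
      have hpt : density p t = C ω + C (v : ℝ) * X := by
        simp [density, p]
      have hpgt : ∀ y, t < y → density p y = density q y := by
        intro y hy
        simp [density, p, hy, hy.ne']
      have hplt : ∀ y, b < y → y < t → y ∉ p.points := by
        intro y _ hy
        rw [← density_eq_zero_iff]
        simp [density, p, hy.ne, hy.le]
      have hmem : t ∈ p.points := by
        by_contra h0
        exact hne (hpt ▸ density_eq_zero_iff.2 h0)
      obtain ⟨e1, e2⟩ := half_congr hpgt
      have hslope : halfSlope p b = d := by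
        rw [halfSlope_step hbt hplt hmem, e1, e2, hq1, hq2, hpt, ← hd, ← mul_assoc, ← C_mul,
          ← hexp, ← Real.exp_add]
        simp
      refine ⟨p, ?_, hslope⟩
      rw [halfValue_step hbt hplt hmem, e1, hq1, hslope, hexp, add_sub_cancel_left, ← hg]

/-! ### The diagonal Green's function at `a` -/

/-- The numerator `φ₊(z, a) φ₋(z, a)` of the Green's function on the diagonal at `a`. -/
noncomputable def greenNumerator (p : MeasurePair) (a : ℝ) : ℝ[X] :=
  halfValue p a * halfValue p.reflect (-a)

/-- The remainder in the decomposition of the Wronskian at `a`. -/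
noncomputable def greenRemainder (p : MeasurePair) (a : ℝ) : ℝ[X] :=
  halfSlope p a * halfValue p.reflect (-a) + halfSlope p.reflect (-a) * halfValue p a

/-- Since `R` has smaller degree than `B`, division of `(B - W) / z` by `B` recovers the mass at `a`
as quotient and `R` as remainder. -/
theorem wronskian_eq_green (p : MeasurePair) (a : ℝ) : wronskian p =
    greenNumerator p a - X * greenRemainder p a - X * (density p a * greenNumerator p a) := by
  rw [wronskian_eq p a, greenNumerator, greenRemainder]; ring

theorem halfValue_ne_zero (p : MeasurePair) (b : ℝ) : halfValue p b ≠ 0 :=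
  (isHerglotzPair_half p b).ne_zero

theorem greenNumerator_ne_zero (p : MeasurePair) (a : ℝ) : greenNumerator p a ≠ 0 :=
  mul_ne_zero (halfValue_ne_zero _ _) (halfValue_ne_zero _ _)

theorem greenNumerator_eval_zero (p : MeasurePair) (a : ℝ) : (greenNumerator p a).eval 0 = 1 := by
  rw [greenNumerator, eval_mul, halfValue_eval_zero, halfValue_eval_zero, one_mul]

theorem degree_mul_add_mul_lt {g g' d d' : ℝ[X]} (h : d.degree < g.degree)
    (h' : d'.degree < g'.degree) : (d * g' + d' * g).degree < (g * g').degree := by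
  have hg : g ≠ 0 := by rintro rfl; exact not_lt_bot h
  have hg' : g' ≠ 0 := by rintro rfl; exact not_lt_bot h'
  refine (degree_add_le _ _).trans_lt (max_lt ?_ ?_)
  · rw [degree_mul, degree_mul]
    exact WithBot.add_lt_add_right (degree_ne_bot.2 hg') h
  · rw [degree_mul, degree_mul, add_comm]
    exact WithBot.add_lt_add_left (degree_ne_bot.2 hg) h'

theorem degree_greenRemainder_lt (p : MeasurePair) (a : ℝ) :
    (greenRemainder p a).degree < (greenNumerator p a).degree :=
  degree_mul_add_mul_lt (isHerglotzPair_half _ _).degree_lt (isHerglotzPair_half _ _).degree_lt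

theorem natDegree_X_mul_le {g d : ℝ[X]} (h : d.degree < g.degree) :
    (X * d).natDegree ≤ g.natDegree := by
  rcases eq_or_ne d 0 with rfl | hd
  · simp
  · rw [natDegree_X_mul hd]
    exact natDegree_lt_natDegree hd h

theorem coeff_X_mul_greenRemainder (p : MeasurePair) (a : ℝ) :
    (X * greenRemainder p a).coeff (greenNumerator p a).natDegree *
      (greenNumerator p a).leadingCoeff ≤ 0 := by
  have h1 := coeff_X_mul_halfSlope_mul_leadingCoeff_nonpos p a
  have h2 := coeff_X_mul_halfSlope_mul_leadingCoeff_nonpos p.reflect (-a)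
  have d1 := natDegree_X_mul_le (isHerglotzPair_half p a).degree_lt
  have d2 := natDegree_X_mul_le (isHerglotzPair_half p.reflect (-a)).degree_lt
  have e : X * greenRemainder p a = (X * halfSlope p a) * halfValue p.reflect (-a) +
      halfValue p a * (X * halfSlope p.reflect (-a)) := by
    rw [greenRemainder]; ring
  rw [e, greenNumerator, natDegree_mul (halfValue_ne_zero _ _) (halfValue_ne_zero _ _), coeff_add,
    coeff_mul_add_eq_of_natDegree_le d1 le_rfl, coeff_mul_add_eq_of_natDegree_le le_rfl d2,
    leadingCoeff_mul, coeff_natDegree, coeff_natDegree]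
  nlinarith [mul_nonneg (neg_nonneg.2 h1) (sq_nonneg (halfValue p.reflect (-a)).leadingCoeff),
    mul_nonneg (neg_nonneg.2 h2) (sq_nonneg (halfValue p a).leadingCoeff)]

theorem natDegree_density_le (p : MeasurePair) (y : ℝ) : (density p y).natDegree ≤ 1 := by
  rw [density, add_comm]; exact natDegree_linear_le

/-- By the sign of the leading coefficients, `B` and `-z R` cannot cancel at the top degree of `B`.
The mass at `a` contributes the rest of the degree of `W`: nothing, one if only `ω` charges `a`, two
if `v` does. -/
theorem natDegree_greenNumerator_le (p : MeasurePair) (a : ℝ) :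
    (greenNumerator p a).natDegree ≤ (wronskian p).natDegree ∧
      (wronskian p).natDegree ≤ (greenNumerator p a).natDegree + 2 := by
  set B := greenNumerator p a with hB
  have hB0 := greenNumerator_ne_zero p a
  set Z := B - X * greenRemainder p a with hZ
  have hZn : Z.natDegree = B.natDegree := by
    refine natDegree_eq_of_le_of_coeff_ne_zero ?_ ?_
    · exact (natDegree_sub_le _ _).trans
        (max_le le_rfl (natDegree_X_mul_le (degree_greenRemainder_lt p a)))
    · rw [hZ, coeff_sub, coeff_natDegree]
      intro h0
      have h1 := coeff_X_mul_greenRemainder p a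
      rw [← sub_eq_zero.1 h0] at h1
      have h2 : B.leadingCoeff ≠ 0 := leadingCoeff_ne_zero.2 hB0
      have := mul_self_pos.2 h2
      linarith
  have hW : wronskian p = Z - X * (density p a * B) := wronskian_eq_green p a
  rcases eq_or_ne (density p a) 0 with hd | hd
  · rw [hW, hd, zero_mul, mul_zero, sub_zero, hZn]
    omega
  · have h3 : (X * (density p a * B)).natDegree = (density p a).natDegree + B.natDegree + 1 := by
      rw [natDegree_X_mul (mul_ne_zero hd hB0), natDegree_mul hd hB0]
    rw [hW, natDegree_sub_eq_right_of_natDegree_lt (by omega), h3]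
    have := natDegree_density_le p a
    omega

theorem sq_eval_phi {p : MeasurePair} {a r : ℝ} (hr : (wronskian p).eval r = 0) :
    (phi p a).eval r ^ 2 = couplingConst p r * (greenNumerator p a).eval r := by
  have h1 : greenNumerator p a = phi p a * phiMinus p a := by
    rw [greenNumerator, halfValue_reflect, halfValue]
    linear_combination phi p a * phiMinus p a * C_exp_half_mul a
  rw [h1, eval_mul, sq]
  nth_rewrite 1 [eval_phi_eq_coupling hr]
  ring

/-! ### Interior spectral data as values of `W` and `B` -/

/-- The interior spectral data in terms of the Wronskian and the numerator of the Green's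
function. -/
structure IsGreenData {N : ℕ} (W B : ℝ[X]) (lam : Fin N → ℝ) (c : Fin N → ℂ) : Prop where
  root_iff : ∀ z : ℂ, aeval z W = 0 ↔ ∃ i, z = lam i
  derivative_ne_zero : ∀ i, (derivative W).eval (lam i) ≠ 0
  residue : ∀ i, B.eval (lam i) = -(lam i * ‖c i‖ ^ 2) * (derivative W).eval (lam i)

theorem IsGreenData.eval_eq_zero {N : ℕ} {W B : ℝ[X]} {lam : Fin N → ℝ} {c : Fin N → ℂ}
    (h : IsGreenData W B lam c) (i : Fin N) : W.eval (lam i) = 0 := by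
  have := (h.root_iff (lam i)).2 ⟨i, rfl⟩
  rwa [aeval_ofReal, Complex.ofReal_eq_zero] at this

theorem norm_normalizedEigenfunction {p : MeasurePair} {r x : ℝ} {g : ℝ → ℂ}
    (hg : IsNormalizedEigenfunction p r g) :
    ‖g x‖ = |(phi p x).eval r| /
      Real.sqrt (r * gammaSq p r (fun x => aeval (r : ℂ) (phi p x))) := by
  obtain ⟨f, hf, hgf⟩ := hg
  rw [isPhiPlus_iff] at hf
  subst hf
  rw [hgf x, norm_div]
  simp only []
  rw [aeval_ofReal, Complex.norm_real, Complex.norm_real, Real.norm_eq_abs,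
    Real.norm_of_nonneg (Real.sqrt_nonneg _)]

/-- The residue condition combines `φ₊(λ, a)² = c B(λ)` with `W'(λ) c = -γ²` and cancels the
coupling constant `c`. The positivity of `λ γ²` is not part of the definitions; both directions
obtain it from `c i ≠ 0`. -/
theorem mem_equimodularPairs_iff {a : ℝ} {N : ℕ} {lam : Fin N → ℝ} {c : Fin N → ℂ}
    (hlam : StrictMono lam) (hc : ∀ i, c i ≠ 0) {q : MeasurePair} :
    q ∈ equimodularPairs a lam c ↔ IsGreenData (wronskian q) (greenNumerator q a) lam c := by
  constructor
  · rintro ⟨c', hdata, hcc⟩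
    have hroot : ∀ z : ℂ, aeval z (wronskian q) = 0 ↔ ∃ i, z = lam i := by
      intro z
      rw [← mem_eigenvalues_iff, hdata.eigenvalues_eq]
      simp [eq_comm]
    have hr : ∀ i, (wronskian q).eval (lam i) = 0 := by
      intro i
      have := (hroot (lam i)).2 ⟨i, rfl⟩
      rwa [aeval_ofReal, Complex.ofReal_eq_zero] at this
    have hkey : ∀ i, 0 < lam i * gammaSq q (lam i) (fun x => aeval (lam i : ℂ) (phi q x)) ∧
        lam i * gammaSq q (lam i) (fun x => aeval (lam i : ℂ) (phi q x)) * ‖c i‖ ^ 2 =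
          (phi q a).eval (lam i) ^ 2 := by
      intro i
      obtain ⟨g, hg, hga⟩ := hdata.value i
      have h1 := norm_normalizedEigenfunction (x := a) hg
      rw [hga, hcc i] at h1
      have hpos : 0 < lam i * gammaSq q (lam i) (fun x => aeval (lam i : ℂ) (phi q x)) := by
        -- If `λ γ² ≤ 0`, the square root and hence the quotient take the default value `0`,
        -- contradicting `c i ≠ 0`.
        by_contra hcon
        rw [Real.sqrt_eq_zero_of_nonpos (not_lt.1 hcon), div_zero, norm_eq_zero] at h1
        exact hc i h1
      refine ⟨hpos, ?_⟩
      rw [h1, div_pow, sq_abs, Real.sq_sqrt hpos.le]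
      exact mul_div_cancel₀ _ hpos.ne'
    refine ⟨hroot, fun i h0 => ?_, fun i => ?_⟩
    · have h1 := derivative_wronskian_mul_couplingConst (hr i)
      have h2 := (hkey i).1
      rw [h0, zero_mul, eq_comm, neg_eq_zero] at h1
      rw [h1, mul_zero] at h2
      exact lt_irrefl _ h2
    · have h1 := derivative_wronskian_mul_couplingConst (hr i)
      have h2 := (hkey i).2
      rw [sq_eval_phi (hr i)] at h2
      refine mul_left_cancel₀ (couplingConst_ne_zero (hr i)) ?_
      linear_combination -h2 + lam i * ‖c i‖ ^ 2 * h1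
  · intro h
    have hkey : ∀ i, lam i * gammaSq q (lam i) (fun x => aeval (lam i : ℂ) (phi q x)) * ‖c i‖ ^ 2 =
          (phi q a).eval (lam i) ^ 2 := by
      intro i
      have h1 := derivative_wronskian_mul_couplingConst (h.eval_eq_zero i)
      rw [sq_eval_phi (h.eval_eq_zero i), h.residue i]
      linear_combination (lam i * ‖c i‖ ^ 2) * h1
    have hpos : ∀ i, 0 < lam i * gammaSq q (lam i) (fun x => aeval (lam i : ℂ) (phi q x)) := by
      intro i
      have hl : lam i ≠ 0 := by
        intro h0
        have := h.eval_eq_zero i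
        rw [h0, wronskian_eval_zero] at this
        exact one_ne_zero this
      have hn : 0 < ‖c i‖ ^ 2 := by have := norm_pos_iff.2 (hc i); positivity
      have h1 : (phi q a).eval (lam i) ≠ 0 := by
        intro h0
        have h2 := sq_eval_phi (a := a) (h.eval_eq_zero i)
        rw [h0, h.residue i] at h2
        have h3 := mul_ne_zero (couplingConst_ne_zero (h.eval_eq_zero i))
          (mul_ne_zero (neg_ne_zero.2 (mul_ne_zero hl hn.ne')) (h.derivative_ne_zero i))
        exact h3 (by rw [← h2]; ring)
      have h2 : 0 < (phi q a).eval (lam i) ^ 2 := by positivity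
      rw [← hkey i] at h2
      exact pos_of_mul_pos_left h2 hn.le
    refine ⟨fun i => aeval (lam i : ℂ) (phi q a) /
      ((Real.sqrt (lam i * gammaSq q (lam i) (fun x => aeval (lam i : ℂ) (phi q x))) : ℝ) : ℂ),
      ⟨hlam, ?_, fun i => ⟨_, ⟨_, isPhiPlus_iff.2 rfl, fun x => rfl⟩, rfl⟩⟩, fun i => ?_⟩
    · ext z
      rw [mem_eigenvalues_iff, h.root_iff]
      simp [eq_comm]
    · rw [norm_div, aeval_ofReal, Complex.norm_real, Complex.norm_real, Real.norm_eq_abs,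
        Real.norm_of_nonneg (Real.sqrt_nonneg _), ← Real.sqrt_sq_eq_abs, ← hkey i,
        Real.sqrt_mul (hpos i).le, Real.sqrt_sq (norm_nonneg _)]
      have := Real.sqrt_pos.2 (hpos i)
      field_simp

theorem eq_of_splits_of_roots {f g : ℝ[X]} (hf : f.Splits) (hg : g.Splits) (hf0 : f.eval 0 = 1)
    (hg0 : g.eval 0 = 1) (h : f.roots = g.roots) : f = g := by
  have e1 := hf.eq_prod_roots
  have e2 := hg.eq_prod_roots
  rw [← h] at e2
  have e3 := congrArg (eval 0) e1
  have e4 := congrArg (eval 0) e2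
  rw [hf0, eval_mul, eval_C] at e3
  rw [hg0, eval_mul, eval_C] at e4
  have e5 : f.leadingCoeff = g.leadingCoeff :=
    mul_right_cancel₀ (right_ne_zero_of_mul (e3 ▸ one_ne_zero)) (e3.symm.trans e4)
  rw [e1, e2, e5]

namespace IsGreenData

variable {N : ℕ} {W B : ℝ[X]} {lam : Fin N → ℝ} {c : Fin N → ℂ}

theorem splits (h : IsGreenData W B lam c) : W.Splits :=
  splits_of_forall_im_eq_zero fun z hz => by
    obtain ⟨i, rfl⟩ := (h.root_iff z).1 hz
    simp

theorem roots_eq (h : IsGreenData W B lam c) (hlam : StrictMono lam) (hW0 : W.eval 0 = 1) :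
    W.roots = Finset.univ.val.map lam := by
  have hW : W ≠ 0 := by rintro rfl; simp at hW0
  have hroot : ∀ x, W.eval x = 0 ↔ ∃ i, x = lam i := by
    intro x
    have := h.root_iff x
    rw [aeval_ofReal] at this
    exact_mod_cast this
  refine (Multiset.Nodup.ext (nodup_roots_of_derivative_ne_zero fun x hx => ?_)
    (Finset.univ.nodup.map hlam.injective)).2 fun x => ?_
  · obtain ⟨i, rfl⟩ := (hroot x).1 hx
    exact h.derivative_ne_zero i
  · rw [mem_roots hW, IsRoot.def, hroot]
    simp [eq_comm]

theorem natDegree_eq (h : IsGreenData W B lam c) (hlam : StrictMono lam) (hW0 : W.eval 0 = 1) :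
    W.natDegree = N := by
  rw [h.splits.natDegree_eq_card_roots, h.roots_eq hlam hW0]; simp

theorem lam_ne_zero (h : IsGreenData W B lam c) (hW0 : W.eval 0 = 1) (i : Fin N) : lam i ≠ 0 := by
  intro h0
  have := h.eval_eq_zero i
  rw [h0, hW0] at this
  exact one_ne_zero this

/-- A polynomial of degree at most `N` is fixed by its values at `N + 1` nodes: the `λᵢ` and `0`,
which is not an eigenvalue because `W(0) = 1`. -/
theorem interpolation_unique (h : IsGreenData W B lam c) (hlam : StrictMono lam)
    (hW0 : W.eval 0 = 1) (hB0 : B.eval 0 = 1) (hdeg : B.natDegree ≤ N) {E : ℝ[X]}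
    (hE : E.natDegree ≤ N) (hE0 : E.eval 0 = 1)
    (hEi : ∀ i, E.eval (lam i) = -(lam i * ‖c i‖ ^ 2) * (derivative W).eval (lam i)) : B = E := by
  have hcard : (insert 0 (Finset.univ.image lam)).card = N + 1 := by
    rw [Finset.card_insert_of_notMem, Finset.card_image_of_injective _ hlam.injective,
      Finset.card_fin]
    simp [h.lam_ne_zero hW0]
  refine eq_of_degrees_lt_of_eval_finset_eq (insert 0 (Finset.univ.image lam)) ?_ ?_ ?_
  · rw [hcard]
    exact degree_le_natDegree.trans_lt (by exact_mod_cast Nat.lt_succ_of_le hdeg)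
  · rw [hcard]
    exact degree_le_natDegree.trans_lt (by exact_mod_cast Nat.lt_succ_of_le hE)
  · intro x hx
    rw [Finset.mem_insert, Finset.mem_image] at hx
    rcases hx with rfl | ⟨i, -, rfl⟩
    · rw [hB0, hE0]
    · rw [h.residue i, hEi i]

/-- Partial fractions of `B / W`: the `λᵢ` values give the simple poles, and the condition `B(0) =
1` makes the constant term equal to `α`. -/
theorem eq_sum (h : IsGreenData W B lam c) (hlam : StrictMono lam)
    (hW0 : W.eval 0 = 1) (hB0 : B.eval 0 = 1) (hdeg : B.natDegree ≤ N) :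
    B = C (alpha c) * W - C W.leadingCoeff *
      ∑ i, C (lam i * ‖c i‖ ^ 2) * ∏ j ∈ Finset.univ.erase i, (X - C (lam j)) := by
  have hWp : W = C W.leadingCoeff * ∏ j, (X - C (lam j)) := by
    conv_lhs => rw [h.splits.eq_prod_roots, h.roots_eq hlam hW0, Multiset.map_map]
    rfl
  have hWi : ∀ i, W = C W.leadingCoeff *
      ((X - C (lam i)) * ∏ j ∈ Finset.univ.erase i, (X - C (lam j))) := by
    intro i
    rw [Finset.mul_prod_erase _ (fun j => X - C (lam j)) (Finset.mem_univ i)]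
    exact hWp
  have hPdeg : ∀ i, (∏ j ∈ Finset.univ.erase i, (X - C (lam j))).natDegree ≤ N := by
    intro i
    rw [natDegree_finsetProd_X_sub_C_eq_card, Finset.card_erase_of_mem (Finset.mem_univ i),
      Finset.card_fin]
    omega
  refine h.interpolation_unique hlam hW0 hB0 hdeg ?_ ?_ ?_
  · refine (natDegree_sub_le _ _).trans (max_le ?_ ?_)
    · exact (natDegree_C_mul_le _ _).trans (h.natDegree_eq hlam hW0).le
    · refine (natDegree_C_mul_le _ _).trans (natDegree_sum_le_of_forall_le _ _ fun i _ => ?_)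
      exact (natDegree_C_mul_le _ _).trans (hPdeg i)
  · rw [eval_sub, eval_mul, hW0, eval_mul, eval_finsetSum, eval_C, eval_C, Finset.mul_sum]
    have : ∀ i, W.leadingCoeff * (C (lam i * ‖c i‖ ^ 2) *
        ∏ j ∈ Finset.univ.erase i, (X - C (lam j))).eval 0 = -‖c i‖ ^ 2 := by
      intro i
      have e := congrArg (eval 0) (hWi i)
      rw [hW0, eval_mul, eval_mul, eval_C, eval_sub, eval_X, eval_C] at e
      rw [eval_mul, eval_C]
      linear_combination ‖c i‖ ^ 2 * e
    simp only [this, Finset.sum_neg_distrib, alpha]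
    ring
  · intro i
    rw [eval_sub, eval_mul, h.eval_eq_zero i, eval_mul, eval_finsetSum, eval_C, mul_zero, zero_sub,
      Finset.sum_eq_single_of_mem i (Finset.mem_univ i)]
    · have e := congrArg (fun P => (derivative P).eval (lam i)) (hWi i)
      simp only [derivative_mul, derivative_C, derivative_sub, derivative_X, eval_mul, eval_add,
        eval_sub, eval_X, eval_C, sub_self, zero_mul, zero_add, sub_zero,
        one_mul, add_zero] at e
      rw [e]
      simp only [eval_mul, eval_C]
      ring
    · intro j _ hj
      rw [eval_mul, eval_prod, Finset.prod_eq_zero (i := i)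
        (Finset.mem_erase.2 ⟨hj.symm, Finset.mem_univ i⟩), mul_zero]
      simp

theorem coeff_eq (h : IsGreenData W B lam c) (hlam : StrictMono lam)
    (hW0 : W.eval 0 = 1) (hB0 : B.eval 0 = 1) (hdeg : B.natDegree ≤ N) :
    B.coeff N = alpha c * W.leadingCoeff := by
  rw [h.eq_sum hlam hW0 hB0 hdeg, coeff_sub, coeff_C_mul, coeff_C_mul, finsetSum_coeff,
    Finset.sum_eq_zero, mul_zero, sub_zero, leadingCoeff, h.natDegree_eq hlam hW0]
  intro i _
  have hN : 0 < N := i.pos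
  rw [coeff_C_mul, coeff_eq_zero_of_natDegree_lt, mul_zero]
  rw [natDegree_finsetProd_X_sub_C_eq_card, Finset.card_erase_of_mem (Finset.mem_univ i),
    Finset.card_fin]
  omega

theorem coeff_pred_eq (h : IsGreenData W B lam c) (hlam : StrictMono lam)
    (hW0 : W.eval 0 = 1) (hB0 : B.eval 0 = 1) (hdeg : B.natDegree ≤ N) (hα : alpha c = 0) :
    B.coeff (N - 1) = beta lam c * W.leadingCoeff := by
  rw [h.eq_sum hlam hW0 hB0 hdeg, hα, C_0, zero_mul, zero_sub, coeff_neg, coeff_C_mul,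
    finsetSum_coeff, beta, neg_mul, mul_comm W.leadingCoeff]
  congr 2
  refine Finset.sum_congr rfl fun i _ => ?_
  have : (∏ j ∈ Finset.univ.erase i, (X - C (lam j))).natDegree = N - 1 := by
    rw [natDegree_finsetProd_X_sub_C_eq_card, Finset.card_erase_of_mem (Finset.mem_univ i),
      Finset.card_fin]
  rw [coeff_C_mul, ← this, coeff_natDegree, (monic_prod_X_sub_C _ _).leadingCoeff, mul_one]

end IsGreenData

/-! ### Polynomials with prescribed zeros, and gluing of configurations -/

/-- The polynomial with simple zeros in `S` and value `1` at `0`. -/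
noncomputable def normalizedNodal (S : Finset ℝ) : ℝ[X] :=
  C (∏ σ ∈ S, (-σ))⁻¹ * ∏ σ ∈ S, (X - C σ)

section NormalizedNodal

variable {S T : Finset ℝ}

theorem prod_neg_inv_ne_zero (h0 : (0 : ℝ) ∉ S) : (∏ σ ∈ S, (-σ))⁻¹ ≠ 0 :=
  inv_ne_zero (Finset.prod_ne_zero_iff.2 fun _ hσ => neg_ne_zero.2 (ne_of_mem_of_not_mem hσ h0))

theorem normalizedNodal_eval_zero (h0 : (0 : ℝ) ∉ S) : (normalizedNodal S).eval 0 = 1 := by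
  rw [normalizedNodal, eval_mul, eval_C, eval_prod]
  simp only [eval_sub, eval_X, eval_C, zero_sub]
  exact inv_mul_cancel₀ fun h => prod_neg_inv_ne_zero h0 (by rw [h, inv_zero])

theorem roots_normalizedNodal (h0 : (0 : ℝ) ∉ S) : (normalizedNodal S).roots = S.val := by
  rw [normalizedNodal, roots_C_mul _ (prod_neg_inv_ne_zero h0), roots_prod_X_sub_C]

theorem splits_normalizedNodal : (normalizedNodal S).Splits :=
  (Splits.prod fun _ _ => Splits.X_sub_C _).C_mul _

theorem normalizedNodal_ne_zero (h0 : (0 : ℝ) ∉ S) : normalizedNodal S ≠ 0 := by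
  intro h
  have := normalizedNodal_eval_zero h0
  rw [h] at this; simp at this

theorem degree_normalizedNodal (h0 : (0 : ℝ) ∉ S) : (normalizedNodal S).degree = S.card := by
  rw [splits_normalizedNodal.degree_eq_card_roots (normalizedNodal_ne_zero h0),
    roots_normalizedNodal h0, Finset.card_val]

theorem normalizedNodal_eval_eq_zero_iff (h0 : (0 : ℝ) ∉ S) {x : ℝ} :
    (normalizedNodal S).eval x = 0 ↔ x ∈ S := by
  rw [← IsRoot.def, ← mem_roots (normalizedNodal_ne_zero h0), roots_normalizedNodal h0,
    Finset.mem_val]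

theorem normalizedNodal_mul_sdiff (h : S ⊆ T) :
    normalizedNodal S * normalizedNodal (T \ S) = normalizedNodal T := by
  rw [normalizedNodal, normalizedNodal, normalizedNodal, ← Finset.prod_sdiff h,
    ← Finset.prod_sdiff h, mul_inv, C_mul]
  ring

theorem isHerglotzPair_normalizedNodal {d : ℝ[X]} (h0 : (0 : ℝ) ∉ S) (hd : d.degree < S.card)
    (hs : ∀ σ ∈ S, d.eval σ * (derivative (normalizedNodal S)).eval σ < 0) :
    IsHerglotzPair (normalizedNodal S) d := by
  refine ⟨normalizedNodal_eval_zero h0, by rwa [degree_normalizedNodal h0], fun z hz => ?_,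
    fun x hx => hs x ((normalizedNodal_eval_eq_zero_iff h0).1 hx)⟩
  rw [normalizedNodal, map_mul, map_prod, aeval_C] at hz
  have h1 := (mul_eq_zero.1 hz).resolve_left
    (Complex.ofReal_ne_zero.2 (prod_neg_inv_ne_zero h0))
  obtain ⟨σ, -, hσ⟩ := Finset.prod_eq_zero_iff.1 h1
  rw [map_sub, aeval_X, aeval_C, sub_eq_zero] at hσ
  rw [hσ]; simp

end NormalizedNodal

theorem ext_density {p q : MeasurePair} (h : ∀ y, density p y = density q y) : p = q :=
  Prod.ext (Finsupp.ext fun y => (density_inj (h y)).1) (Finsupp.ext fun y => (density_inj (h y)).2)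

theorem eq_of_half_eq {p q : MeasurePair} {a : ℝ} (hg : halfValue p a = halfValue q a)
    (hd : halfSlope p a = halfSlope q a)
    (hg' : halfValue p.reflect (-a) = halfValue q.reflect (-a))
    (hd' : halfSlope p.reflect (-a) = halfSlope q.reflect (-a))
    (ha : density p a = density q a) : p = q := by
  refine ext_density fun y => ?_
  rcases lt_trichotomy y a with h | rfl | h
  · have := density_eq_of_half_eq hg' hd' (-y) (neg_lt_neg h)
    rwa [density_reflect, density_reflect, neg_neg] at this
  · exact ha
  · exact density_eq_of_half_eq hg hd y h

theorem exists_glue (p q r : MeasurePair) (a : ℝ) : ∃ s : MeasurePair,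
    (∀ y, a < y → density s y = density p y) ∧ density s a = density q a ∧
      ∀ y, y < a → density s y = density r y := by
  refine ⟨((p.1.filter (a < ·) + r.1.filter (· < a)).update a (q.1 a),
    (p.2.filter (a < ·) + r.2.filter (· < a)).update a (q.2 a)), ?_, ?_, ?_⟩
  · intro y hy
    simp [density, hy, hy.ne', hy.le]
  · simp [density]
  · intro y hy
    simp [density, hy, hy.ne, hy.le]

/-! ### Counting the pairs with given `W` and `B` -/

section Count

variable {p : MeasurePair} {a : ℝ}

/-- At a common zero of `g₊` and `g₋` both `B` and `R` vanish, hence also `W`. -/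
theorem halfValue_reflect_eval_ne_zero (h : ∀ x, (greenNumerator p a).eval x = 0 →
    (wronskian p).eval x ≠ 0) {x : ℝ} (hx : (halfValue p a).eval x = 0) :
    (halfValue p.reflect (-a)).eval x ≠ 0 := by
  intro hx'
  refine h x (by rw [greenNumerator, eval_mul, hx, zero_mul]) ?_
  rw [wronskian_eq_green p a, greenNumerator, greenRemainder]
  simp [hx, hx']

/-- At a zero of one factor of `B`, the product `R B'` is `d g'` of that half-line times the square
of the other factor. So `R / B` has the residue signs of a Herglotz function, independently of how
`B` is factored. -/
theorem greenRemainder_mul_derivative_neg (h : ∀ x, (greenNumerator p a).eval x = 0 →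
    (wronskian p).eval x ≠ 0) {x : ℝ} (hx : (greenNumerator p a).eval x = 0) :
    (greenRemainder p a).eval x * (derivative (greenNumerator p a)).eval x < 0 := by
  have hx0 := hx
  rw [greenNumerator, eval_mul] at hx
  rcases mul_eq_zero.1 hx with h1 | h1
  · have h2 := halfValue_reflect_eval_ne_zero h h1
    have h3 := (isHerglotzPair_half p a).sign x h1
    have h4 : 0 < (halfValue p.reflect (-a)).eval x ^ 2 := sq_pos_iff.2 h2
    have : (greenRemainder p a).eval x * (derivative (greenNumerator p a)).eval x =
        (halfSlope p a).eval x * (derivative (halfValue p a)).eval x *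
          (halfValue p.reflect (-a)).eval x ^ 2 := by
      rw [greenRemainder, greenNumerator]
      simp [h1]; ring
    rw [this]
    exact mul_neg_of_neg_of_pos h3 h4
  · have h2 : (halfValue p a).eval x ≠ 0 := fun h2 => halfValue_reflect_eval_ne_zero h h2 h1
    have h3 := (isHerglotzPair_half p.reflect (-a)).sign x h1
    have h4 : 0 < (halfValue p a).eval x ^ 2 := sq_pos_iff.2 h2
    have : (greenRemainder p a).eval x * (derivative (greenNumerator p a)).eval x =
        (halfSlope p.reflect (-a)).eval x * (derivative (halfValue p.reflect (-a))).eval x *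
          (halfValue p a).eval x ^ 2 := by
      rw [greenRemainder, greenNumerator]
      simp [h1]; ring
    rw [this]
    exact mul_neg_of_neg_of_pos h3 h4

theorem greenNumerator_splits : (greenNumerator p a).Splits :=
  (isHerglotzPair_half p a).splits.mul (isHerglotzPair_half p.reflect (-a)).splits

theorem nodup_roots_greenNumerator (h : ∀ x, (greenNumerator p a).eval x = 0 →
    (wronskian p).eval x ≠ 0) : (greenNumerator p a).roots.Nodup :=
  nodup_roots_of_derivative_ne_zero fun x hx h0 => by
    have := greenRemainder_mul_derivative_neg h hx
    rw [h0, mul_zero] at this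
    exact lt_irrefl _ this

/-- The zeros of `g₊` determine both factors of `B`; division with remainder gives the mass at `a`
and `R`; and at the zeros of `g₊` the relation `R = d₊ g₋` fixes `d₊`. Uniqueness on each half-line
finishes. -/
theorem eq_of_roots_halfValue_eq (h : ∀ x, (greenNumerator p a).eval x = 0 →
    (wronskian p).eval x ≠ 0) {q q' : MeasurePair}
    (hq : wronskian q = wronskian p ∧ greenNumerator q a = greenNumerator p a)
    (hq' : wronskian q' = wronskian p ∧ greenNumerator q' a = greenNumerator p a)
    (hr : (halfValue q a).roots.toFinset = (halfValue q' a).roots.toFinset) : q = q' := by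
  have H := isHerglotzPair_half q a
  have H' := isHerglotzPair_half q' a
  have K := isHerglotzPair_half q.reflect (-a)
  have K' := isHerglotzPair_half q'.reflect (-a)
  have hq0 : ∀ x, (greenNumerator q a).eval x = 0 → (wronskian q).eval x ≠ 0 := by
    rw [hq.1, hq.2]; exact h
  have hg : halfValue q a = halfValue q' a := by
    refine eq_of_splits_of_roots H.splits H'.splits H.eval_zero H'.eval_zero ?_
    rw [← H.nodup_roots.dedup, ← H'.nodup_roots.dedup, ← Multiset.toFinset_val,
      ← Multiset.toFinset_val, hr]
  have hB := hq.2.trans hq'.2.symm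
  have hg' : halfValue q.reflect (-a) = halfValue q'.reflect (-a) := by
    rw [greenNumerator, greenNumerator, ← hg] at hB
    exact mul_left_cancel₀ H.ne_zero hB
  have hW := hq.1.trans hq'.1.symm
  rw [wronskian_eq_green q a, wronskian_eq_green q' a, ← hB] at hW
  have hW' : (density q a - density q' a) * greenNumerator q a =
      greenRemainder q' a - greenRemainder q a := by
    refine mul_left_cancel₀ (X_ne_zero (R := ℝ)) ?_
    linear_combination -hW
  have ha : density q a = density q' a := by
    by_contra hcon
    have e2 : (greenRemainder q' a - greenRemainder q a).degree < (greenNumerator q a).degree := by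
      refine (degree_sub_le _ _).trans_lt (max_lt ?_ (degree_greenRemainder_lt q a))
      rw [hB]; exact degree_greenRemainder_lt q' a
    rw [← hW', degree_mul] at e2
    exact absurd e2 (not_lt.2 (le_add_of_nonneg_left (zero_le_degree_iff.2 (sub_ne_zero.2 hcon))))
  have hR : greenRemainder q a = greenRemainder q' a := by
    rw [ha, sub_self, zero_mul] at hW'
    exact (sub_eq_zero.1 hW'.symm).symm
  rw [greenRemainder, greenRemainder, ← hg, ← hg'] at hR
  have hd : halfSlope q a = halfSlope q' a := by
    have hcard : ((halfValue q a).roots.toFinset.card : WithBot ℕ) = (halfValue q a).degree := by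
      rw [H.card_roots, degree_eq_natDegree H.ne_zero]
    refine eq_of_degrees_lt_of_eval_finset_eq (halfValue q a).roots.toFinset
      (hcard ▸ H.degree_lt) ?_ ?_
    · rw [hcard, hg]; exact H'.degree_lt
    · intro x hx
      have hx := H.mem_roots_iff.1 hx
      have e := congrArg (eval x) hR
      simp only [eval_add, eval_mul, hx, mul_zero, add_zero] at e
      exact mul_right_cancel₀ (halfValue_reflect_eval_ne_zero hq0 hx) e
  have hd' : halfSlope q.reflect (-a) = halfSlope q'.reflect (-a) := by
    rw [hd] at hR
    exact mul_right_cancel₀ H.ne_zero (add_left_cancel hR)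
  exact eq_of_half_eq hg hd hg' hd' ha

theorem exists_roots_halfValue_eq (h : ∀ x, (greenNumerator p a).eval x = 0 →
    (wronskian p).eval x ≠ 0) {S : Finset ℝ} (hS : S ⊆ (greenNumerator p a).roots.toFinset) :
    ∃ q : MeasurePair, (wronskian q = wronskian p ∧ greenNumerator q a = greenNumerator p a) ∧
      (halfValue q a).roots.toFinset = S := by
  set T := (greenNumerator p a).roots.toFinset with hT
  have hmem : ∀ x, x ∈ T ↔ (greenNumerator p a).eval x = 0 := by
    intro x
    rw [hT, Multiset.mem_toFinset, mem_roots (greenNumerator_ne_zero p a), IsRoot.def]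
  have hT0 : (0 : ℝ) ∉ T := by
    rw [hmem, greenNumerator_eval_zero]; exact one_ne_zero
  have hS0 : (0 : ℝ) ∉ S := fun h0 => hT0 (hS h0)
  have hS0' : (0 : ℝ) ∉ T \ S := fun h0 => hT0 (Finset.mem_sdiff.1 h0).1
  set B := greenNumerator p a with hB
  set R := greenRemainder p a with hR
  set g := normalizedNodal S with hg
  set g' := normalizedNodal (T \ S) with hg'
  have hBT : B = normalizedNodal T := by
    refine eq_of_splits_of_roots greenNumerator_splits splits_normalizedNodal
      (greenNumerator_eval_zero p a) (normalizedNodal_eval_zero hT0) ?_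
    rw [roots_normalizedNodal hT0, hT, Multiset.toFinset_val, (nodup_roots_greenNumerator h).dedup]
  have hprod : g * g' = B := by rw [hBT]; exact normalizedNodal_mul_sdiff hS
  have hgS : ∀ σ ∈ S, g.eval σ = 0 ∧ g'.eval σ ≠ 0 := by
    intro σ hσ
    rw [hg, hg', normalizedNodal_eval_eq_zero_iff hS0, Ne, normalizedNodal_eval_eq_zero_iff hS0']
    exact ⟨hσ, fun h1 => (Finset.mem_sdiff.1 h1).2 hσ⟩
  have hgS' : ∀ σ ∈ T \ S, g'.eval σ = 0 ∧ g.eval σ ≠ 0 := by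
    intro σ hσ
    rw [hg, hg', normalizedNodal_eval_eq_zero_iff hS0', Ne, normalizedNodal_eval_eq_zero_iff hS0]
    exact ⟨hσ, (Finset.mem_sdiff.1 hσ).2⟩
  have hB' : derivative B = derivative g * g' + g * derivative g' := by
    rw [← hprod, derivative_mul]
  have hneg : ∀ σ ∈ T, R.eval σ * (derivative B).eval σ < 0 := fun σ hσ =>
    greenRemainder_mul_derivative_neg h ((hmem σ).1 hσ)
  -- The values forced by `R = d g' + d' g` at the zeros of `g` and of `g'`. The signs of `R B'`
  -- make both pairs Herglotz.
  set d := Lagrange.interpolate S id (fun σ => R.eval σ / g'.eval σ) with hd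
  set d' := Lagrange.interpolate (T \ S) id (fun σ => R.eval σ / g.eval σ) with hd'
  have hde : ∀ σ ∈ S, d.eval σ = R.eval σ / g'.eval σ := fun σ hσ =>
    Lagrange.eval_interpolate_at_node _ Function.injective_id.injOn hσ
  have hde' : ∀ σ ∈ T \ S, d'.eval σ = R.eval σ / g.eval σ := fun σ hσ =>
    Lagrange.eval_interpolate_at_node _ Function.injective_id.injOn hσ
  have H : IsHerglotzPair g d := by
    refine isHerglotzPair_normalizedNodal hS0
      (Lagrange.degree_interpolate_lt _ Function.injective_id.injOn) fun σ hσ => ?_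
    have h1 := hneg σ (hS hσ)
    have h2 := (hgS σ hσ).2
    rw [hB', eval_add, eval_mul, eval_mul, (hgS σ hσ).1, zero_mul, add_zero] at h1
    have h3 : d.eval σ * (derivative g).eval σ =
        R.eval σ * ((derivative g).eval σ * g'.eval σ) / g'.eval σ ^ 2 := by
      rw [hde σ hσ]; field_simp
    rw [h3]
    exact div_neg_of_neg_of_pos h1 (by positivity)
  have H' : IsHerglotzPair g' d' := by
    refine isHerglotzPair_normalizedNodal hS0'
      (Lagrange.degree_interpolate_lt _ Function.injective_id.injOn) fun σ hσ => ?_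
    have h1 := hneg σ (Finset.mem_sdiff.1 hσ).1
    have h2 := (hgS' σ hσ).2
    rw [hB', eval_add, eval_mul, eval_mul, (hgS' σ hσ).1, mul_zero, zero_add] at h1
    have h3 : d'.eval σ * (derivative g').eval σ =
        R.eval σ * (g.eval σ * (derivative g').eval σ) / g.eval σ ^ 2 := by
      rw [hde' σ hσ]; field_simp
    rw [h3]
    exact div_neg_of_neg_of_pos h1 (by positivity)
  have hRdec : R = d * g' + d' * g := by
    have hcard : (T.card : WithBot ℕ) = B.degree := by rw [hBT, degree_normalizedNodal hT0]
    refine eq_of_degrees_lt_of_eval_finset_eq T (hcard ▸ degree_greenRemainder_lt p a) ?_ ?_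
    · rw [hcard, ← hprod]
      exact degree_mul_add_mul_lt H.degree_lt H'.degree_lt
    · intro σ hσ
      by_cases hσS : σ ∈ S
      · have := (hgS σ hσS).2
        rw [eval_add, eval_mul, eval_mul, (hgS σ hσS).1, hde σ hσS]; field_simp; ring
      · have hσ' := Finset.mem_sdiff.2 ⟨hσ, hσS⟩
        have := (hgS' σ hσ').2
        rw [eval_add, eval_mul, eval_mul, (hgS' σ hσ').1, hde' σ hσ']; field_simp; ring
  obtain ⟨q₁, hq₁, hq₁'⟩ := H.exists_half a
  obtain ⟨q₂, hq₂, hq₂'⟩ := H'.exists_half (-a)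
  -- The mass at `a` is kept from `p`, since it is already determined by `W` and `B`.
  obtain ⟨q, hqr, hqa, hql⟩ := exists_glue q₁ p q₂.reflect a
  obtain ⟨e1, e2⟩ := half_congr hqr
  obtain ⟨e3, e4⟩ := half_congr (p := q.reflect) (q := q₂) (b := -a) fun y hy => by
    rw [density_reflect, hql (-y) (by linarith), density_reflect, neg_neg]
  have hBq : greenNumerator q a = B := by rw [greenNumerator, e1, e3, hq₁, hq₂, hprod]
  have hRq : greenRemainder q a = R := by
    rw [greenRemainder, e1, e2, e3, e4, hq₁, hq₂, hq₁', hq₂', hRdec]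
  refine ⟨q, ⟨?_, hBq⟩, ?_⟩
  · rw [wronskian_eq_green q a, wronskian_eq_green p a, hBq, hRq, hqa]
  · rw [e1, hq₁, hg, roots_normalizedNodal hS0]
    exact Finset.val_toFinset S

/-- The map sending a pair to the zero set of its `g₊` is a bijection onto the subsets of the simple
zeros of `B`. -/
theorem encard_setOf_wronskian_eq (h : ∀ x, (greenNumerator p a).eval x = 0 →
    (wronskian p).eval x ≠ 0) :
    {q : MeasurePair | wronskian q = wronskian p ∧
      greenNumerator q a = greenNumerator p a}.encard = 2 ^ (greenNumerator p a).natDegree := by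
  have himg : (fun q : MeasurePair => (halfValue q a).roots.toFinset) ''
      {q : MeasurePair | wronskian q = wronskian p ∧ greenNumerator q a = greenNumerator p a} =
      ((greenNumerator p a).roots.toFinset.powerset : Set (Finset ℝ)) := by
    ext S
    simp only [Set.mem_image, Set.mem_ofPred_eq, Finset.mem_coe, Finset.mem_powerset]
    constructor
    · rintro ⟨q, ⟨-, hq⟩, rfl⟩ x hx
      rw [Multiset.mem_toFinset, mem_roots (greenNumerator_ne_zero p a), IsRoot.def, ← hq,
        greenNumerator, eval_mul, (isHerglotzPair_half q a).mem_roots_iff.1 hx, zero_mul]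
    · exact exists_roots_halfValue_eq h
  have hinj : Set.InjOn (fun q : MeasurePair => (halfValue q a).roots.toFinset)
      {q : MeasurePair | wronskian q = wronskian p ∧ greenNumerator q a = greenNumerator p a} :=
    fun q hq q' hq' hr => eq_of_roots_halfValue_eq h hq hq' hr
  rw [← hinj.encard_image, himg, Set.encard_coe_eq_coe_finsetCard,
    Finset.card_powerset, Multiset.toFinset_card_of_nodup (nodup_roots_greenNumerator h),
    ← greenNumerator_splits.natDegree_eq_card_roots]
  push_cast; rfl

end Count

theorem encard_equimodularPairs {a : ℝ} {p : MeasurePair} {N : ℕ} {lam : Fin N → ℝ}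
    {c : Fin N → ℂ} (hlam : StrictMono lam) (hc : ∀ i, c i ≠ 0)
    (h : IsGreenData (wronskian p) (greenNumerator p a) lam c) :
    (equimodularPairs a lam c).encard = 2 ^ (greenNumerator p a).natDegree := by
  have hdeg : ∀ q, IsGreenData (wronskian q) (greenNumerator q a) lam c →
      (greenNumerator q a).natDegree ≤ N := fun q hq =>
    (natDegree_greenNumerator_le q a).1.trans (hq.natDegree_eq hlam (wronskian_eval_zero q)).le
  rw [← encard_setOf_wronskian_eq (p := p) (a := a)]
  · congr 1
    ext q
    rw [mem_equimodularPairs_iff hlam hc, Set.mem_ofPred_eq]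
    constructor
    · intro hq
      have hW : wronskian q = wronskian p := by
        refine eq_of_splits_of_roots hq.splits h.splits (wronskian_eval_zero q)
          (wronskian_eval_zero p) ?_
        rw [hq.roots_eq hlam (wronskian_eval_zero q), h.roots_eq hlam (wronskian_eval_zero p)]
      refine ⟨hW, hq.interpolation_unique hlam (wronskian_eval_zero q)
        (greenNumerator_eval_zero q a) (hdeg q hq) (hdeg p h) (greenNumerator_eval_zero p a) ?_⟩
      rw [hW]; exact h.residue
    · rintro ⟨h1, h2⟩
      rw [h1, h2]; exact h
  · intro x hx hWx
    have := (h.root_iff x).1 (by rw [aeval_ofReal, hWx]; simp)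
    obtain ⟨i, hi⟩ := this
    have hi : x = lam i := by exact_mod_cast hi
    rw [hi, h.residue i] at hx
    refine mul_ne_zero (neg_ne_zero.2 (mul_ne_zero (h.lam_ne_zero (wronskian_eval_zero p) i) ?_))
      (h.derivative_ne_zero i) hx
    exact pow_ne_zero 2 (norm_ne_zero_iff.2 (hc i))


/-! ### The three cases: reading off the degree of `B` -/

theorem encard_equimodularPairs_cases (a : ℝ) (p : MeasurePair) {N : ℕ}
    (lam : Fin N → ℝ) (c : Fin N → ℂ)
    (hdata : IsInteriorSpectralData p a lam c)
    (hc : ∀ i, c i ≠ 0) :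
    (alpha c = 0 → beta lam c = 0 →
      2 ≤ N ∧ (equimodularPairs a lam c).encard = 2 ^ (N - 2)) ∧
    (alpha c = 0 → beta lam c ≠ 0 →
      1 ≤ N ∧ (equimodularPairs a lam c).encard = 2 ^ (N - 1)) ∧
    (alpha c ≠ 0 →
      (equimodularPairs a lam c).encard = 2 ^ N) := by
  have hlam := hdata.strictMono
  have h := (mem_equimodularPairs_iff hlam hc).1 ⟨c, hdata, fun _ => rfl⟩
  have hW0 := wronskian_eval_zero p
  have hB0 := greenNumerator_eval_zero p a
  have hN := h.natDegree_eq hlam hW0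
  obtain ⟨hle, hge⟩ := natDegree_greenNumerator_le p a
  rw [hN] at hle hge
  have hcoeff := h.coeff_eq hlam hW0 hB0 hle
  have hcoeff' := h.coeff_pred_eq hlam hW0 hB0 hle
  have hlead : (wronskian p).leadingCoeff ≠ 0 :=
    leadingCoeff_ne_zero.2 fun h0 => by rw [h0] at hW0; simp at hW0
  have hBlead : (greenNumerator p a).coeff (greenNumerator p a).natDegree ≠ 0 :=
    leadingCoeff_ne_zero.2 (greenNumerator_ne_zero p a)
  rw [encard_equimodularPairs hlam hc h]
  have hpos : alpha c = 0 → 1 ≤ N := by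
    intro hα
    rcases Nat.eq_zero_or_pos N with rfl | h1
    · simp [alpha] at hα
    · exact h1
  have hlt : alpha c = 0 → (greenNumerator p a).natDegree ≠ N := by
    intro hα h1
    rw [h1, hcoeff, hα, zero_mul] at hBlead
    exact hBlead rfl
  refine ⟨fun hα hβ => ?_, fun hα hβ => ?_, fun hα => ?_⟩
  · have h1 : (greenNumerator p a).natDegree ≠ N - 1 := by
      intro h1
      rw [h1, hcoeff' hα, hβ, zero_mul] at hBlead
      exact hBlead rfl
    have := hpos hα
    have := hlt hα
    -- The bound `N ≤ deg B + 2` leaves only this degree. For `N = 1` the excluded values `N` and `N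
    -- - 1` would exhaust all degrees, so `N ≥ 2`.
    have h2 : 2 ≤ N ∧ (greenNumerator p a).natDegree = N - 2 := by omega
    exact ⟨h2.1, by rw [h2.2]⟩
  · have h1 : N - 1 ≤ (greenNumerator p a).natDegree :=
      le_natDegree_of_ne_zero (by rw [hcoeff' hα]; exact mul_ne_zero hβ hlead)
    have hN1 := hpos hα
    have := hlt hα
    exact ⟨hN1, by rw [show (greenNumerator p a).natDegree = N - 1 by omega]⟩
  · have h1 : N ≤ (greenNumerator p a).natDegree :=
      le_natDegree_of_ne_zero (by rw [hcoeff]; exact mul_ne_zero hα hlead)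
    rw [le_antisymm hle h1]

end PeakonString

theorem theorem3p10 (a : ℝ) (p : PeakonString.MeasurePair) {N : ℕ}
    (lam : Fin N → ℝ) (c : Fin N → ℂ)
    (hdata : PeakonString.IsInteriorSpectralData p a lam c)
    (hc : ∀ i, c i ≠ 0) :
    (PeakonString.alpha c = 0 → PeakonString.beta lam c = 0 →
      2 ≤ N ∧ (PeakonString.equimodularPairs a lam c).encard = 2 ^ (N - 2)) ∧
    (PeakonString.alpha c = 0 → PeakonString.beta lam c ≠ 0 →
      1 ≤ N ∧ (PeakonString.equimodularPairs a lam c).encard = 2 ^ (N - 1)) ∧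
    (PeakonString.alpha c ≠ 0 →
      (PeakonString.equimodularPairs a lam c).encard = 2 ^ N) :=
  PeakonString.encard_equimodularPairs_cases a p lam c hdata hc
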